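/- For complex $a$, $q$ and integers $n \ge 0$ let $(a;q)_n = \prod_{j=0}^{n-1}(1-aq^j)$ and $(a_1,\dots,a_m;q)_n = (a_1;q)_n\cdots(a_m;q)_n$, and let $\psi(q) = \sum_{n=0}^\infty q^{n(n+1)/2}$ for $|q|<1$. Let $q$ and $\rho_1$ be complex numbers with $0<|q|<1$ and $|\rho_1|>1$, and let $i=\sqrt{-1}$. Then all the series below converge absolutely, and $$\begin{aligned} \psi^2(q^4) &= \frac{i}{2q} \left(\sum_{n=1}^{\infty} \frac{(1+iq^{4n-1})(-i/q, -i/q; q^2)_n (q^2; q^2)_{2n-1} (-iq)^n}{(1+i/q)(q^2, q^2; q^2)_n (-1; q^2)_{2n}} - \sum_{n=1}^{\infty} \frac{(1-iq^{4n-1})(i/q, i/q; q^2)_n (q^2; q^2)_{2n-1} (iq)^n}{(1-i/q)(q^2, q^2; q^2)_n (-1; q^2)_{2n}} \right)\\ &= \frac{1}{2iq} \left(\sum_{n=1}^{\infty} \frac{(i\rho_1 q; q^2)_n (-1)^n}{(-iq/\rho_1; q^2)_n (1-q^{2n}) \rho_1^n} - \sum_{n=1}^{\infty} \frac{(-i\rho_1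 q; q^2)_n (-1)^n}{(iq/\rho_1; q^2)_n (1-q^{2n}) \rho_1^n} \right. \\ &\qquad + \sum_{n=1}^{\infty} \frac{(1-iq^{4n-1})(i/q, \rho_1; q^2)_n (q^2; q^2)_{2n-1} (-1)^n}{(1-i/q)(iq/\rho_1, q^2; q^2)_n (-1; q^2)_{2n} \rho_1^n} \\ &\qquad \left. - \sum_{n=1}^{\infty} \frac{(1+iq^{4n-1})(-i/q, \rho_1; q^2)_n (q^2; q^2)_{2n-1} (-1)^n}{(1+i/q)(-iq/\rho_1, q^2; q^2)_n (-1; q^2)_{2n} \rho_1^n} \right)\\ &= \sum_{n=0}^{\infty} \frac{(-1)^n q^{4n^2+4n}}{1-q^{4n+2}} + \frac{1}{2iq} \left(\sum_{n=1}^{\infty} \frac{(1-iq^{4n-1})(i/q; q^2)_n (q^2; q^2)_{2n-1} q^{n^2-n}}{(1-i/q)(q^2; q^2)_n (-1; q^2)_{2n}} - \sum_{n=1}^{\infty} \frac{(1+iq^{4n-1})(-i/q; q^2)_n (q^2; q^2)_{2n-1} q^{n^2-n}}{(1+i/q)(q^2; q^2)_n (-1; q^2)_{2n}} \right). \end{aligned}$$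 -/

import Mathlib

/-- The finite `q`-shifted factorial `(a; q)_n = ∏_{j=0}^{n-1} (1 - a q^j)`. A symbol with several
parameters `(a₁, …, aₘ; q)_n` is the product of the `(aⱼ; q)_n`. -/
def qPoch (a q : ℂ) (n : ℕ) : ℂ :=
  ∏ j ∈ Finset.range n, (1 - a * q ^ j)

/-- Ramanujan's theta function `ψ(q) = ∑_{n ≥ 0} q^{n(n+1)/2}`, for `|q| < 1`. -/
noncomputable def ramanujanPsi (q : ℂ) : ℂ :=
  ∑' n : ℕ, q ^ (n * (n + 1) / 2)

/-! Put `p = q²` and `x = 1/ρ`. All three formulas come from one transformation with free parameters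
`a` and `x`, `hasSum_transformation`: a well-poised series equals a Lambert series in `a` alone plus
a very-well-poised series.

To prove it, expand the quotient `∏ (x - a⁻¹ p^j) / (1 - a p x p^j)` by the terminating `₆φ₅` sum
(`sixPhiFive`) with the parameter `y = p^{-n}`, and interchange the two summations. The inner sums
over `n` are then `q`-Gauss sums (`hasSum_qGauss`). The `k = 0` term of the expansion, which is free
of `x`, sums to the Lambert series (`hasSum_qGaussDeriv`).

The interchange needs `|a² p| < 1`, while the formulas use `a = ∓i/q`, where `a² p = -1`. For `|x| <
1` the factors containing `x` decay geometrically, so dominated convergence along `r a`, `r → 1⁻`,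
reaches the boundary (`hasSum_transformation_of_eq_neg_one`).

Subtracting the cases `a = -i/q` and `a = i/q` leaves `2iq ∑ q^{2j} / (1 + q^{4j+2})` from the
Lambert series, and this is `2iq ψ(q⁴)²` (`hasSum_psi_sq`, itself from `₆φ₅`, Gauss's product for
`ψ` and a rearrangement). The three formulas are the choices `x = a⁻¹`, which annihilates the
well-poised series, `x = 1/ρ₁`, and `x = 0`, that is, `ρ = ∞`. -/

open Filter Topology

/-! ### Shifted factorials and the terminating `₆φ₅` sum -/

/-- The homogeneous form `∏_{j<n} (x - b p^j)` of the `q`-shifted factorial. -/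
def qNum (b x p : ℂ) (n : ℕ) : ℂ :=
  ∏ j ∈ Finset.range n, (x - b * p ^ j)

@[simp] lemma qPoch_zero (a p : ℂ) : qPoch a p 0 = 1 := by simp [qPoch]

lemma qPoch_succ (a p : ℂ) (n : ℕ) : qPoch a p (n + 1) = qPoch a p n * (1 - a * p ^ n) := by
  simp [qPoch, Finset.prod_range_succ]

@[simp] lemma qNum_zero (b x p : ℂ) : qNum b x p 0 = 1 := by simp [qNum]

lemma qNum_succ (b x p : ℂ) (n : ℕ) : qNum b x p (n + 1) = qNum b x p n * (x - b * p ^ n) := by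
  simp [qNum, Finset.prod_range_succ]

lemma qPoch_ne_zero {a p : ℂ} {n : ℕ} (h : ∀ j < n, a * p ^ j ≠ 1) : qPoch a p n ≠ 0 := by
  rw [qPoch, Finset.prod_ne_zero_iff]
  intro j hj
  exact sub_ne_zero.2 (h j (Finset.mem_range.1 hj)).symm

lemma qPoch_succ' (a p : ℂ) (n : ℕ) : qPoch a p (n + 1) = (1 - a) * qPoch (a * p) p n := by
  simp only [qPoch, Finset.prod_range_succ', pow_zero, mul_one]
  rw [mul_comm]
  congr 1
  exact Finset.prod_congr rfl fun j _ => by ring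

lemma qPoch_add (a p : ℂ) (m n : ℕ) :
    qPoch a p (m + n) = qPoch a p m * qPoch (a * p ^ m) p n := by
  simp only [qPoch, Finset.prod_range_add]
  congr 1
  exact Finset.prod_congr rfl fun j _ => by ring

/-- The part of the very-well-poised `₆φ₅` summand that does not depend on the length of the sum,
without its factor `1 - a p^{2k}`. -/
noncomputable def wellPoised (a x y p : ℂ) (k : ℕ) : ℂ :=
  qPoch a p k / ((1 - a) * qPoch p p k) * (qNum 1 x p k / qPoch (a * p * x) p k) *
    (qNum 1 y p k / qPoch (a * p * y) p k) * ∏ j ∈ Finset.range k, (-a * p ^ (j + 1))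

lemma wellPoised_succ (a x y p : ℂ) (k : ℕ) :
    wellPoised a x y p (k + 1) = wellPoised a x y p k *
      ((1 - a * p ^ k) * (x - p ^ k) * (y - p ^ k) * (-a * p ^ (k + 1)) /
        ((1 - p ^ (k + 1)) * (1 - a * p * x * p ^ k) * (1 - a * p * y * p ^ k))) := by
  simp only [wellPoised, qPoch_succ, qNum_succ, Finset.prod_range_succ, one_mul, ← pow_succ',
    div_eq_mul_inv, mul_inv]
  ring

/-- The telescoping step behind the terminating `₆φ₅` summation. -/
lemma sixPhiFive_certificate {a x y p K M A Q R d₁ d₂ d₃ d₄ d₅ d₆ : ℂ} (hQ : Q ≠ 0) (hR : R ≠ 0)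
    (e₁ : d₁ = 1 - p * M) (e₅ : d₅ = 1 - a * p * (K * K * M))
    (n₁ : d₁ ≠ 0) (n₂ : d₂ ≠ 0) (n₃ : d₃ ≠ 0) (n₄ : d₄ ≠ 0) (n₅ : d₅ ≠ 0) (n₆ : d₆ ≠ 0) :
    -A * (M * p) * (1 - K) * (1 - a * K * x) * (1 - a * K * y) * d₅ / (Q * d₁ * (R * d₅)) +
      A * (1 - a * (K * K)) *
        ((1 - K * (M * p)) * (1 - a * (K * (M * p)) * x) * (1 - a * (K * (M * p)) * y) /
            (Q * d₁ * (R * d₅)) -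
          (1 - a * (K * (M * p)) * x * y) * d₁ * d₅ / (Q * d₁ * (R * d₅))) =
    -(A * ((1 - a * K) * (x - K) * (y - K) * (-a * (K * p)) / (d₂ * d₃ * d₄))) * M * d₂ * d₃ * d₄ *
        d₆ / (Q * (R * d₅ * d₆)) := by
  field_simp
  rw [e₁, e₅]
  ring

section sixPhiFive

variable {a x y p : ℂ}

/-- With `n = k + m`, the summand is the combination of the `₆φ₅` summands of lengths `n` and `n -
1` that should sum to zero by the first-order recurrence in `n`. It is a difference in `j`, so its
partial sums have a closed form. Writing `m` for `n - k` keeps truncated subtraction out of the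
induction on `k`. -/
lemma sixPhiFive_partial (hp : ∀ j : ℕ, p * p ^ j ≠ 1) (ha : ∀ j : ℕ, a * p ^ j ≠ 1)
    (hx : ∀ j : ℕ, a * p * x * p ^ j ≠ 1) (hy : ∀ j : ℕ, a * p * y * p ^ j ≠ 1)
    (k m : ℕ) :
    ∑ j ∈ Finset.range k, wellPoised a x y p j * (1 - a * p ^ (2 * j)) *
        ((1 - p ^ (k + m)) * (1 - a * p ^ (k + m) * x) * (1 - a * p ^ (k + m) * y) /
            (qPoch p p (k + m - j) * qPoch (a * p) p (k + m + j)) -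
          (1 - a * p ^ (k + m) * x * y) * (1 - p ^ (k + m - j)) * (1 - a * p ^ (k + m + j)) /
            (qPoch p p (k + m - j) * qPoch (a * p) p (k + m + j))) =
      -wellPoised a x y p k * p ^ m * (1 - p ^ k) * (1 - a * p ^ k * x) * (1 - a * p ^ k * y) *
        (1 - a * p ^ (k + k + m)) / (qPoch p p m * qPoch (a * p) p (k + k + m)) := by
  induction k generalizing m with
  | zero => simp
  | succ k ih =>
    rw [Finset.sum_range_succ]
    have := ih (m + 1)
    rw [show k + 1 + m = k + (m + 1) by ring, this, wellPoised_succ]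
    have e1 : k + (m + 1) - k = m + 1 := by omega
    have e2 : k + (m + 1) + k = k + k + m + 1 := by ring
    have e3 : k + 1 + (k + 1) + m = k + k + m + 1 + 1 := by ring
    have e4 : k + k + (m + 1) = k + k + m + 1 := by ring
    rw [e1, e2, e3, e4]
    simp only [qPoch_succ]
    have n1 : qPoch p p m ≠ 0 := qPoch_ne_zero fun j _ => hp j
    have n2 : qPoch (a * p) p (k + k + m) ≠ 0 := qPoch_ne_zero fun j _ => by
      have := ha (j + 1); rwa [pow_succ', ← mul_assoc] at this
    have n3 : 1 - p * p ^ m ≠ 0 := sub_ne_zero.2 (hp m).symm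
    have n4 : 1 - p * p ^ k ≠ 0 := sub_ne_zero.2 (hp k).symm
    have n5 : 1 - a * p * x * p ^ k ≠ 0 := sub_ne_zero.2 (hx k).symm
    have n6 : 1 - a * p * y * p ^ k ≠ 0 := sub_ne_zero.2 (hy k).symm
    have n7 : 1 - a * p * p ^ (k + k + m) ≠ 0 := by
      have := ha (k + k + m + 1)
      rw [pow_succ', ← mul_assoc] at this
      exact sub_ne_zero.2 this.symm
    have n8 : 1 - a * p * p ^ (k + k + m + 1) ≠ 0 := by
      have := ha (k + k + m + 2)
      rw [pow_succ', ← mul_assoc] at this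
      exact sub_ne_zero.2 this.symm
    have := sixPhiFive_certificate (A := wellPoised a x y p k) (x := x) (y := y) (K := p ^ k)
      n1 n2 rfl (by ring : 1 - a * p * p ^ (k + k + m) = _) n3 n4 n5 n6 n7 n8
    convert this using 1
    · congr 1
      · congr 1; ring
      · congr 1
        · ring
        · congr 1
          · congr 1; ring
          · congr 1; ring
    · congr 1
      ring

end sixPhiFive

/-- The terminating very-well-poised `₆φ₅` summation, in terms of the reciprocals `x`, `y` of two of
its parameters. -/
theorem sixPhiFive {a x y p : ℂ} (hp : ∀ j : ℕ, p * p ^ j ≠ 1) (ha : ∀ j : ℕ, a * p ^ j ≠ 1)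
    (hx : ∀ j : ℕ, a * p * x * p ^ j ≠ 1) (hy : ∀ j : ℕ, a * p * y * p ^ j ≠ 1) (n : ℕ) :
    ∑ k ∈ Finset.range (n + 1), wellPoised a x y p k * (1 - a * p ^ (2 * k)) /
        (qPoch p p (n - k) * qPoch (a * p) p (n + k)) =
      qPoch (a * p * x * y) p n /
        (qPoch p p n * qPoch (a * p * x) p n * qPoch (a * p * y) p n) := by
  induction n with
  | zero =>
    have : 1 - a ≠ 0 := sub_ne_zero.2 (by simpa using (ha 0).symm)
    simp [wellPoised, this]
  | succ n ih =>
    -- At `m = 0` the sum covers `j ≤ n`, and the right side is, up to sign, the missing summand `k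
    -- = n + 1` of the longer sum with its recurrence coefficient.
    have key := sixPhiFive_partial hp ha hx hy (n + 1) 0
    simp only [add_zero] at key
    have hap : ∀ j : ℕ, a * p * p ^ j ≠ 1 := fun j => by
      have := ha (j + 1); rwa [pow_succ', ← mul_assoc] at this
    have h2 : ∑ k ∈ Finset.range (n + 1), wellPoised a x y p k * (1 - a * p ^ (2 * k)) *
        ((1 - a * p ^ (n + 1) * x * y) * (1 - p ^ (n + 1 - k)) * (1 - a * p ^ (n + 1 + k)) /
            (qPoch p p (n + 1 - k) * qPoch (a * p) p (n + 1 + k))) =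
        (1 - a * p ^ (n + 1) * x * y) * ∑ k ∈ Finset.range (n + 1),
          wellPoised a x y p k * (1 - a * p ^ (2 * k)) /
            (qPoch p p (n - k) * qPoch (a * p) p (n + k)) := by
      rw [Finset.mul_sum]
      refine Finset.sum_congr rfl fun k hk => ?_
      have hk' : k ≤ n := Nat.lt_succ_iff.1 (Finset.mem_range.1 hk)
      rw [show n + 1 - k = n - k + 1 by omega, show n + 1 + k = n + k + 1 by ring, qPoch_succ,
        qPoch_succ, show a * p ^ (n + k + 1) = a * p * p ^ (n + k) by ring,
        show p ^ (n - k + 1) = p * p ^ (n - k) by ring]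
      have n1 : 1 - p * p ^ (n - k) ≠ 0 := sub_ne_zero.2 (hp _).symm
      have n2 : 1 - a * p * p ^ (n + k) ≠ 0 := sub_ne_zero.2 (hap _).symm
      have n3 : qPoch p p (n - k) ≠ 0 := qPoch_ne_zero fun j _ => hp j
      have n4 : qPoch (a * p) p (n + k) ≠ 0 := qPoch_ne_zero fun j _ => hap j
      generalize 1 - a * p * p ^ (n + k) = d at *
      field_simp
    have h1 : ∑ k ∈ Finset.range (n + 1), wellPoised a x y p k * (1 - a * p ^ (2 * k)) *
        ((1 - p ^ (n + 1)) * (1 - a * p ^ (n + 1) * x) * (1 - a * p ^ (n + 1) * y) /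
            (qPoch p p (n + 1 - k) * qPoch (a * p) p (n + 1 + k))) =
        (1 - p ^ (n + 1)) * (1 - a * p ^ (n + 1) * x) * (1 - a * p ^ (n + 1) * y) *
          ∑ k ∈ Finset.range (n + 1), wellPoised a x y p k * (1 - a * p ^ (2 * k)) /
            (qPoch p p (n + 1 - k) * qPoch (a * p) p (n + 1 + k)) := by
      rw [Finset.mul_sum]
      refine Finset.sum_congr rfl fun k hk => ?_
      ring
    replace key := (Finset.sum_congr rfl fun k _ => (mul_sub _ _ _).symm).trans key
    rw [Finset.sum_sub_distrib, h1, h2, ih] at key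
    rw [Finset.sum_range_succ]
    have n1 : 1 - p * p ^ n ≠ 0 := sub_ne_zero.2 (hp _).symm
    have n2 : 1 - a * p * x * p ^ n ≠ 0 := sub_ne_zero.2 (hx _).symm
    have n3 : 1 - a * p * y * p ^ n ≠ 0 := sub_ne_zero.2 (hy _).symm
    have n4 : qPoch p p n ≠ 0 := qPoch_ne_zero fun j _ => hp j
    have n5 : qPoch (a * p * x) p n ≠ 0 := qPoch_ne_zero fun j _ => hx j
    have n6 : qPoch (a * p * y) p n ≠ 0 := qPoch_ne_zero fun j _ => hy j
    have e1 : p ^ (n + 1) = p * p ^ n := by ring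
    have e2 : a * p ^ (n + 1) * x = a * p * x * p ^ n := by ring
    have e3 : a * p ^ (n + 1) * y = a * p * y * p ^ n := by ring
    have e4 : a * p ^ (n + 1) * x * y = a * p * x * y * p ^ n := by ring
    have e5 : a * p ^ (2 * (n + 1)) = a * p ^ (n + 1 + (n + 1)) := by ring
    rw [e4, e2, e3, e1] at key
    rw [qPoch_succ, qPoch_succ, qPoch_succ, qPoch_succ, e5]
    simp only [Nat.sub_self, qPoch_zero, one_mul] at key ⊢
    generalize 1 - p * p ^ n = d₁ at *
    generalize 1 - a * p * x * p ^ n = d₂ at *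
    generalize 1 - a * p * y * p ^ n = d₃ at *
    generalize ∑ k ∈ Finset.range (n + 1), wellPoised a x y p k * (1 - a * p ^ (2 * k)) /
            (qPoch p p (n + 1 - k) * qPoch (a * p) p (n + 1 + k)) = S at *
    have : d₁ * d₂ * d₃ * (S + wellPoised a x y p (n + 1) * (1 - a * p ^ (n + 1 + (n + 1))) /
        qPoch (a * p) p (n + 1 + (n + 1))) = (1 - a * p * x * y * p ^ n) *
          (qPoch (a * p * x * y) p n /
        (qPoch p p n * qPoch (a * p * x) p n * qPoch (a * p * y) p n)) := by
      linear_combination key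
    have n7 : d₁ * d₂ * d₃ ≠ 0 := by positivity
    rw [← mul_right_inj' n7, this]
    field_simp

/-! ### Uniform bounds and limits for shifted factorials -/

section bounds

/-- The exponents `A t^j` sum to at most `A / (1 - t)`, so such a product is a bounded multiple of
`s^n`. All later bounds reduce to this through `1 + u ≤ exp u`. -/
lemma norm_prod_le_exp {f : ℕ → ℂ} {s A t : ℝ} (hs : 0 ≤ s) (hA : 0 ≤ A) (ht0 : 0 ≤ t) (ht : t < 1)
    (h : ∀ j, ‖f j‖ ≤ s * Real.exp (A * t ^ j)) (n : ℕ) :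
    ‖∏ j ∈ Finset.range n, f j‖ ≤ Real.exp (A * (1 - t)⁻¹) * s ^ n := by
  rw [norm_prod]
  calc ∏ j ∈ Finset.range n, ‖f j‖ ≤ ∏ j ∈ Finset.range n, s * Real.exp (A * t ^ j) :=
        Finset.prod_le_prod (fun _ _ => norm_nonneg _) fun j _ => h j
    _ = Real.exp (A * ∑ j ∈ Finset.range n, t ^ j) * s ^ n := by
        rw [Finset.prod_mul_distrib, Finset.prod_const, Finset.card_range, ← Real.exp_sum,
          Finset.mul_sum, mul_comm]
    _ ≤ _ := by
        gcongr
        rw [← tsum_geometric_of_lt_one ht0 ht]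
        exact (summable_geometric_of_lt_one ht0 ht).sum_le_tsum _ fun _ _ => by positivity

variable {p : ℂ}

lemma exists_norm_qPoch_le (hp : ‖p‖ < 1) {R : ℝ} (hR : 0 ≤ R) :
    ∃ C : ℝ, 0 < C ∧ ∀ c : ℂ, ‖c‖ ≤ R → ∀ n, ‖qPoch c p n‖ ≤ C := by
  refine ⟨_, Real.exp_pos (R * (1 - ‖p‖)⁻¹), fun c hc n => ?_⟩
  have := norm_prod_le_exp (f := fun j => 1 - c * p ^ j) zero_le_one hR (norm_nonneg p) hp
    (fun j => ?_) n
  · simpa [qPoch] using this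
  · calc ‖1 - c * p ^ j‖ ≤ 1 + ‖c‖ * ‖p‖ ^ j := by
          simpa using norm_sub_le (1 : ℂ) (c * p ^ j)
      _ ≤ R * ‖p‖ ^ j + 1 := by rw [add_comm]; gcongr
      _ ≤ _ := by rw [one_mul]; exact Real.add_one_le_exp _

lemma exists_norm_qPoch_inv_le (hp : ‖p‖ < 1) {R : ℝ} (hR : 0 ≤ R) (hR1 : R < 1) :
    ∃ C : ℝ, 0 < C ∧ ∀ c : ℂ, ‖c‖ ≤ R → ∀ n, ‖(qPoch c p n)⁻¹‖ ≤ C := by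
  have h1R : 0 < 1 - R := by linarith
  refine ⟨_, Real.exp_pos (R / (1 - R) * (1 - ‖p‖)⁻¹), fun c hc n => ?_⟩
  have := norm_prod_le_exp (f := fun j => (1 - c * p ^ j)⁻¹) zero_le_one
    (div_nonneg hR h1R.le) (norm_nonneg p) hp (fun j => ?_) n
  · simpa [qPoch] using this
  · have hu : ‖c * p ^ j‖ ≤ R * ‖p‖ ^ j := by
      rw [norm_mul, norm_pow]; gcongr
    have hu2 : R * ‖p‖ ^ j ≤ R := mul_le_of_le_one_right hR (pow_le_one₀ (norm_nonneg _) hp.le)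
    have h2 : 1 - R * ‖p‖ ^ j ≤ ‖1 - c * p ^ j‖ := by
      have := norm_sub_norm_le (1 : ℂ) (c * p ^ j)
      rw [norm_one] at this
      linarith
    have h3 : 0 < 1 - R * ‖p‖ ^ j := by linarith
    rw [norm_inv, one_mul]
    refine (inv_anti₀ h3 h2).trans (le_trans ?_ (Real.add_one_le_exp _))
    have hu0 : 0 ≤ R * ‖p‖ ^ j := by positivity
    rw [inv_le_iff_one_le_mul₀ h3, div_mul_eq_mul_div, div_add_one h1R.ne', div_mul_eq_mul_div,
      le_div_iff₀ h1R]
    nlinarith [mul_nonneg hu0 (sub_nonneg.2 hu2)]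

/-- The decay `s^n` is what replaces `|a² p| < 1` on the boundary; uniformity in `b` is needed
because there `b = a⁻¹` varies. -/
lemma exists_norm_qNum_le (hp : ‖p‖ < 1) {s : ℝ} (hs : 0 < s) :
    ∃ C : ℝ, 0 < C ∧ ∀ b x : ℂ, ‖b‖ ≤ 1 → ‖x‖ ≤ s → ∀ n, ‖qNum b x p n‖ ≤ C * s ^ n := by
  refine ⟨_, Real.exp_pos (s⁻¹ * (1 - ‖p‖)⁻¹), fun b x hb hx n => ?_⟩
  refine norm_prod_le_exp hs.le (inv_nonneg.2 hs.le) (norm_nonneg p) hp (fun j => ?_) n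
  calc ‖x - b * p ^ j‖ ≤ ‖x‖ + ‖b‖ * ‖p‖ ^ j := by
        simpa using norm_sub_le x (b * p ^ j)
    _ ≤ s + 1 * ‖p‖ ^ j := by gcongr
    _ = s * (s⁻¹ * ‖p‖ ^ j + 1) := by field_simp; ring
    _ ≤ _ := by gcongr; exact Real.add_one_le_exp _

lemma mul_pow_ne_one {c : ℂ} (hp : ‖p‖ < 1) (hc : ‖c‖ < 1) (j : ℕ) : c * p ^ j ≠ 1 := by
  intro h
  have h1 : ‖c * p ^ j‖ = 1 := by rw [h, norm_one]
  rw [norm_mul, norm_pow] at h1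
  have : ‖c‖ * ‖p‖ ^ j ≤ ‖c‖ := mul_le_of_le_one_right (norm_nonneg _)
    (pow_le_one₀ (norm_nonneg _) hp.le)
  linarith

lemma qPoch_ne_zero_of_norm_lt {c : ℂ} (hp : ‖p‖ < 1) (hc : ‖c‖ < 1) (n : ℕ) :
    qPoch c p n ≠ 0 :=
  qPoch_ne_zero fun j _ => mul_pow_ne_one hp hc j

lemma exists_tendsto_qPoch {c : ℂ} (hp : ‖p‖ < 1) (hc : ‖c‖ < 1) :
    ∃ l : ℂ, l ≠ 0 ∧ Tendsto (qPoch c p) atTop (𝓝 l) := by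
  have hs : Summable fun j : ℕ => ‖-(c * p ^ j)‖ := by
    simp only [norm_neg, norm_mul, norm_pow]
    exact (summable_geometric_of_lt_one (norm_nonneg _) hp).mul_left _
  refine ⟨∏' j, (1 + -(c * p ^ j)), tprod_one_add_ne_zero_of_summable (fun j => ?_) hs, ?_⟩
  · rw [← sub_eq_add_neg]
    exact sub_ne_zero.2 (mul_pow_ne_one hp hc j).symm
  · have := (multipliable_one_add_of_summable hs).hasProd.tendsto_prod_nat
    refine this.congr fun n => ?_
    simp only [qPoch, sub_eq_add_neg]

end bounds

/-! ### The `q`-Gauss sum by telescoping -/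

section telescoping

lemma hasSum_of_telescoping {f g : ℕ → ℂ} (hf : Summable f) (h : ∀ n, f n = g (n + 1) - g n)
    (hg : Tendsto g atTop (𝓝 0)) : HasSum f (-g 0) := by
  rw [hf.hasSum_iff_tendsto_nat]
  simp only [h, Finset.sum_range_sub]
  simpa using hg.sub_const (g 0)

variable {b p y : ℂ}

lemma summable_bounded_mul_pow {f : ℕ → ℂ} {C : ℝ} (hy : ‖y‖ < 1) (hf : ∀ n, ‖f n‖ ≤ C) :
    Summable fun n => f n * y ^ n := by
  refine .of_norm_bounded ((summable_geometric_of_lt_one (norm_nonneg y) hy).mul_left C) fun n => ?_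
  rw [norm_mul, norm_pow]
  gcongr
  exact hf n

lemma hasSum_qGauss_zero (hp : ‖p‖ < 1) (hy : ‖y‖ < 1) (hby : ‖b * y‖ < 1) :
    HasSum (fun m => qPoch b p m / qPoch (b * y) p (m + 1) * y ^ m) (1 / (1 - y)) := by
  obtain ⟨C, hC, hC'⟩ := exists_norm_qPoch_le hp (norm_nonneg b)
  obtain ⟨D, hD, hD'⟩ := exists_norm_qPoch_inv_le hp (norm_nonneg _) hby
  have hy1 : 1 - y ≠ 0 := sub_ne_zero.2 fun h => by simp [← h] at hy
  have bd : ∀ m k, ‖qPoch b p m / qPoch (b * y) p k‖ ≤ C * D := fun m k => by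
    rw [div_eq_mul_inv, norm_mul]
    exact mul_le_mul (hC' _ le_rfl _) (hD' _ le_rfl _) (norm_nonneg _) hC.le
  have := hasSum_of_telescoping (f := fun m => qPoch b p m / qPoch (b * y) p (m + 1) * y ^ m)
    (g := fun m => -(qPoch b p m / qPoch (b * y) p m * y ^ m) / (1 - y))
    (summable_bounded_mul_pow hy fun m => bd m (m + 1)) (fun m => ?_) ?_
  · simpa [neg_div] using this
  · have n1 : qPoch (b * y) p m ≠ 0 := qPoch_ne_zero_of_norm_lt hp hby m
    have n2 : 1 - b * y * p ^ m ≠ 0 := sub_ne_zero.2 (mul_pow_ne_one hp hby m).symm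
    simp only [qPoch_succ]
    field_simp
    ring
  · have := ((summable_bounded_mul_pow hy fun m => bd m m).tendsto_atTop_zero.neg).div_const (1 - y)
    simpa using this

/-- The `q`-Gauss summation when one of the upper parameters is a positive power of the base. -/
theorem hasSum_qGauss (hp : ‖p‖ < 1) (hy : ‖y‖ < 1) (hby : ‖b * y‖ < 1) (N : ℕ) :
    HasSum (fun m => qPoch b p m * qPoch p p (N + m) /
      (qPoch p p m * qPoch (b * y) p (N + 1 + m)) * y ^ m) (qPoch p p N / qPoch y p (N + 1)) := by
  obtain ⟨C, hC, hC'⟩ := exists_norm_qPoch_le hp (norm_nonneg b)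
  obtain ⟨D, hD, hD'⟩ := exists_norm_qPoch_inv_le hp (norm_nonneg _) hby
  obtain ⟨E, hE, hE'⟩ := exists_norm_qPoch_le hp (norm_nonneg p)
  obtain ⟨F, hF, hF'⟩ := exists_norm_qPoch_inv_le hp (norm_nonneg _) hp
  have bd : ∀ m k l i, ‖qPoch b p m * qPoch p p k / (qPoch p p l * qPoch (b * y) p i)‖ ≤
      C * E * (F * D) := fun m k l i => by
    rw [div_eq_mul_inv, mul_inv, norm_mul, norm_mul, norm_mul]
    exact mul_le_mul (mul_le_mul (hC' _ le_rfl _) (hE' _ le_rfl _) (norm_nonneg _) hC.le)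
      (mul_le_mul (hF' _ le_rfl _) (hD' _ le_rfl _) (norm_nonneg _) hF.le)
      (by positivity) (by positivity)
  have hn : ∀ m, qPoch p p m ≠ 0 := qPoch_ne_zero_of_norm_lt hp hp
  induction N with
  | zero =>
    convert hasSum_qGauss_zero hp hy hby using 1
    · ext m
      rw [zero_add, zero_add, add_comm 1 m, mul_comm (qPoch b p m), mul_div_mul_left _ _ (hn m)]
    · simp [qPoch_succ]
  | succ N ih =>
    have s1 := fun N => summable_bounded_mul_pow hy fun m => bd m (N + m) m (N + 1 + m)
    have hyN : 1 - y * p ^ (N + 1) ≠ 0 := sub_ne_zero.2 (mul_pow_ne_one hp hy _).symm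
    -- With `S_N` the sum in question, the series of `(1 - y p^{N+1}) S_{N+1} - (1 - p^{N+1}) S_N`
    -- telescopes. The primitive contains `1 - p^m`, hence vanishes at `m = 0`, and the combination
    -- is zero.
    have := hasSum_of_telescoping
      (g := fun m => -p ^ (N + 1) * (1 - p ^ m) * (qPoch b p m * qPoch p p (N + m) /
        (qPoch p p m * qPoch (b * y) p (N + 1 + m)) * y ^ m))
      (((s1 (N + 1)).mul_left (1 - y * p ^ (N + 1))).sub ((s1 N).mul_left (1 - p ^ (N + 1))))
      (fun m => ?_) ?_
    · have h2 := (this.add (ih.mul_left (1 - p ^ (N + 1)))).mul_left (1 - y * p ^ (N + 1))⁻¹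
      convert h2 using 1
      · rfl
      · ext m
        rw [sub_add_cancel, inv_mul_cancel_left₀ hyN]
      · simp only [pow_zero, sub_self, mul_zero, zero_mul, neg_zero, zero_add]
        rw [qPoch_succ, qPoch_succ y p (N + 1), ← pow_succ', mul_comm (qPoch p p N),
          ← mul_div_assoc, mul_comm (qPoch y p (N + 1)), ← div_div, inv_mul_eq_div,
          div_right_comm]
    · have n1 : qPoch (b * y) p (N + 1 + m) ≠ 0 := qPoch_ne_zero_of_norm_lt hp hby _
      have n2 : 1 - b * y * p ^ (N + 1 + m) ≠ 0 := sub_ne_zero.2 (mul_pow_ne_one hp hby _).symm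
      have n3 : 1 - p * p ^ m ≠ 0 := sub_ne_zero.2 (mul_pow_ne_one hp hp _).symm
      have n4 := hn m
      have key : ∀ {B P Q R S Y M d f : ℂ}, S ≠ 0 → R ≠ 0 → f ≠ 0 → d ≠ 0 →
          d = 1 - b * y * (Q * M) →
          (1 - y * Q) * (B * (P * (1 - Q * M)) / (S * (R * d)) * Y) - (1 - Q) * (B * P / (S * R) * Y)
          = -Q * f * (B * (1 - b * M) * (P * (1 - Q * M)) / (S * f * (R * d)) * (Y * y)) -
            -Q * (1 - M) * (B * P / (S * R) * Y) := by
        intro B P Q R S Y M d f hS hR hf hd e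
        field_simp
        rw [e]
        ring
      have := key (B := qPoch b p m) (P := qPoch p p (N + m)) (Y := y ^ m) n4 n1 n3 n2
        (by rw [pow_add] : _ = 1 - b * y * (p ^ (N + 1) * p ^ m))
      convert this using 2
      · rw [show N + 1 + m = N + m + 1 by ring, qPoch_succ p p (N + m),
          show N + 1 + 1 + m = N + m + 1 + 1 by ring,
          qPoch_succ _ _ (N + m + 1)]
        congr 5
        ring
      · rw [show N + 1 + (m + 1) = N + 1 + m + 1 by ring, show N + (m + 1) = N + m + 1 by ring]
        simp only [qPoch_succ _ _ (N + m), qPoch_succ _ _ (N + 1 + m), qPoch_succ _ _ m]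
        rw [show p * p ^ (N + m) = p ^ (N + 1) * p ^ m by ring, pow_succ' p m, pow_succ y m]
    · have h1 : Tendsto (fun m : ℕ => -p ^ (N + 1) * (1 - p ^ m)) atTop
          (𝓝 (-p ^ (N + 1) * (1 - 0))) :=
        ((tendsto_pow_atTop_nhds_zero_of_norm_lt_one hp).const_sub 1).const_mul _
      simpa using h1.mul (s1 N).tendsto_atTop_zero

end telescoping

/-! ### The derivative of the `q`-Gauss sum as a Lambert series -/

section lambert

variable {b p y : ℂ}

lemma norm_inv_one_sub_le {c : ℂ} {r : ℝ} (hc : ‖c‖ ≤ r) (hr : r < 1) :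
    ‖(1 - c)⁻¹‖ ≤ (1 - r)⁻¹ := by
  rw [norm_inv]
  refine inv_anti₀ (by linarith) ?_
  have := norm_sub_norm_le (1 : ℂ) c
  rw [norm_one] at this
  linarith

lemma norm_pow_succ_le (hp : ‖p‖ < 1) (n : ℕ) : ‖p ^ (n + 1)‖ ≤ ‖p‖ := by
  rw [norm_pow]
  exact pow_le_of_le_one (norm_nonneg _) hp.le n.succ_ne_zero

lemma one_sub_pow_succ_ne_zero (hp : ‖p‖ < 1) (n : ℕ) : 1 - p ^ (n + 1) ≠ 0 := by
  rw [pow_succ']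
  exact sub_ne_zero.2 (mul_pow_ne_one hp hp n).symm

/-- The summand of the logarithmic derivative of the `q`-Gauss sum. -/
noncomputable def qGaussDeriv (b p y : ℂ) (n : ℕ) : ℂ :=
  qPoch b p (n + 1) / (qPoch (b * y) p (n + 1) * (1 - p ^ (n + 1))) * y ^ (n + 1)

lemma exists_norm_qGaussDeriv_le (hp : ‖p‖ < 1) (hby : ‖b * y‖ < 1) :
    ∃ C : ℝ, 0 < C ∧ ∀ y' : ℂ, ‖y'‖ ≤ ‖y‖ → ∀ n, ‖qGaussDeriv b p y' n‖ ≤ C * ‖y'‖ ^ (n + 1) := by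
  obtain ⟨C, hC, hC'⟩ := exists_norm_qPoch_le hp (norm_nonneg b)
  obtain ⟨D, hD, hD'⟩ := exists_norm_qPoch_inv_le hp (norm_nonneg _) hby
  have hp1 : 0 < 1 - ‖p‖ := by linarith
  refine ⟨C * (D * (1 - ‖p‖)⁻¹), by positivity, fun y' hy' n => ?_⟩
  rw [qGaussDeriv, div_eq_mul_inv, mul_inv, norm_mul, norm_mul, norm_mul, norm_pow]
  gcongr
  · exact hC' _ le_rfl _
  · refine hD' _ ?_ _
    rw [norm_mul, norm_mul]
    gcongr
  · exact norm_inv_one_sub_le (norm_pow_succ_le hp n) hp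

lemma summable_qGaussDeriv (hp : ‖p‖ < 1) (hy : ‖y‖ < 1) (hby : ‖b * y‖ < 1) :
    Summable (qGaussDeriv b p y) := by
  obtain ⟨C, hC, hC'⟩ := exists_norm_qGaussDeriv_le hp hby
  exact .of_norm_bounded (((summable_nat_add_iff 1).2
    (summable_geometric_of_lt_one (norm_nonneg y) hy)).mul_left C) (hC' y le_rfl)

/-- Replacing `y` by `y p` changes each summand by the next summand of the `N = 0` `q`-Gauss series,
so the difference is that sum without its first term. Iterating `y ↦ y p` produces the Lambert
series. -/
lemma tsum_qGaussDeriv_sub (hp : ‖p‖ < 1) (hy : ‖y‖ < 1) (hby : ‖b * y‖ < 1) :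
    ∑' n, qGaussDeriv b p y n - ∑' n, qGaussDeriv b p (y * p) n =
      y / (1 - y) - b * y / (1 - b * y) := by
  have hyp : ‖y * p‖ < 1 := by
    rw [norm_mul]; exact mul_lt_one_of_nonneg_of_lt_one_left (norm_nonneg _) hy hp.le
  have hbyp : ‖b * (y * p)‖ < 1 := by
    rw [← mul_assoc, norm_mul]
    exact mul_lt_one_of_nonneg_of_lt_one_left (norm_nonneg _) hby hp.le
  rw [← (summable_qGaussDeriv hp hy hby).tsum_sub (summable_qGaussDeriv hp hyp hbyp)]
  have h0 := hasSum_qGauss_zero (b := b) hp hy hby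
  have h1 := (hasSum_nat_add_iff' 1).2 h0
  have hy1 : 1 - y ≠ 0 := sub_ne_zero.2 fun h => by simp [← h] at hy
  have hby1 : 1 - b * y ≠ 0 := sub_ne_zero.2 fun h => by simp [← h] at hby
  have e : ∀ n, qGaussDeriv b p y n - qGaussDeriv b p (y * p) n =
      qPoch b p (n + 1) / qPoch (b * y) p (n + 1 + 1) * y ^ (n + 1) := fun n => by
    have n1 := qPoch_ne_zero_of_norm_lt hp hby (n + 1)
    have n2 := qPoch_ne_zero_of_norm_lt hp hbyp (n + 1)
    have n3 : 1 - b * y * p ^ (n + 1) ≠ 0 := sub_ne_zero.2 (mul_pow_ne_one hp hby _).symm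
    have n4 := one_sub_pow_succ_ne_zero hp n
    have e1 : qPoch (b * y) p (n + 1) * (1 - b * y * p ^ (n + 1)) =
        (1 - b * y) * qPoch (b * (y * p)) p (n + 1) := by
      rw [← qPoch_succ, qPoch_succ', mul_assoc]
    have e2 : qPoch (b * (y * p)) p (n + 1) =
      qPoch (b * y) p (n + 1) * (1 - b * y * p ^ (n + 1)) / (1 - b * y) := by
      rw [e1]; field_simp
    rw [qGaussDeriv, qGaussDeriv, qPoch_succ (b * y) p (n + 1), mul_pow, e2]
    generalize p ^ (n + 1) = P at *
    generalize y ^ (n + 1) = Y at *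
    field_simp
    ring
  simp only [e]
  rw [h1.tsum_eq]
  have aux : ∀ {c : ℂ}, 1 - c ≠ 0 → c / (1 - c) = 1 / (1 - c) - 1 := fun {c} hc => by
    field_simp
    ring
  rw [aux hy1, aux hby1]
  simp [qPoch_succ]

/-- The value at `ε = 1` of the derivative of the `q`-Gauss sum as a Lambert series. -/
theorem hasSum_qGaussDeriv (hp : ‖p‖ < 1) (hy : ‖y‖ < 1) (hby : ‖b * y‖ < 1) :
    HasSum (qGaussDeriv b p y)
      (∑' i : ℕ, (y * p ^ i / (1 - y * p ^ i) - b * y * p ^ i / (1 - b * y * p ^ i))) := by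
  have hle : ∀ N, ‖y * p ^ N‖ ≤ ‖y‖ := fun N => by
    rw [norm_mul, norm_pow]
    exact mul_le_of_le_one_right (norm_nonneg _) (pow_le_one₀ (norm_nonneg _) hp.le)
  have hle' : ∀ N, ‖b * (y * p ^ N)‖ ≤ ‖b * y‖ := fun N => by
    rw [norm_mul b, norm_mul b]; gcongr; exact hle N
  have hS : ∀ N, ∑' n, qGaussDeriv b p y n = ∑ i ∈ Finset.range N,
      (y * p ^ i / (1 - y * p ^ i) - b * y * p ^ i / (1 - b * y * p ^ i)) +
        ∑' n, qGaussDeriv b p (y * p ^ N) n := fun N => by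
    induction N with
    | zero => simp
    | succ N ih =>
      have := tsum_qGaussDeriv_sub hp ((hle N).trans_lt hy) ((hle' N).trans_lt hby)
      rw [Finset.sum_range_succ, ih, pow_succ, ← mul_assoc, mul_assoc b y]
      linear_combination this
  obtain ⟨C, hC, hC'⟩ := exists_norm_qGaussDeriv_le hp hby
  have hlim : Tendsto (fun N => ∑' n, qGaussDeriv b p (y * p ^ N) n) atTop (𝓝 0) := by
    have hb : ∀ N : ℕ, ‖∑' n, qGaussDeriv b p (y * p ^ N) n‖ ≤
        C * (1 - ‖y‖)⁻¹ * (‖y‖ * ‖p‖ ^ N) := fun N => by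
      have h1 : ∀ n, ‖qGaussDeriv b p (y * p ^ N) n‖ ≤ C * (‖y‖ * ‖p‖ ^ N) * ‖y‖ ^ n := fun n => by
        refine (hC' _ (hle N) n).trans ?_
        rw [pow_succ', ← norm_pow p, ← norm_mul, mul_assoc]
        gcongr
        exact hle N
      refine (tsum_of_norm_bounded
        ((hasSum_geometric_of_lt_one (norm_nonneg y) hy).mul_left _) h1).trans_eq (by ring)
    refine squeeze_zero_norm hb ?_
    simpa using ((tendsto_pow_atTop_nhds_zero_of_lt_one (norm_nonneg p) hp).const_mul
      ‖y‖).const_mul (C * (1 - ‖y‖)⁻¹)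
  have hsum : Summable fun i : ℕ =>
      (y * p ^ i / (1 - y * p ^ i) - b * y * p ^ i / (1 - b * y * p ^ i)) := by
    have aux : ∀ c : ℂ, ‖c‖ < 1 → Summable fun i : ℕ => c * p ^ i / (1 - c * p ^ i) := fun c hc => by
      refine .of_norm_bounded ((summable_geometric_of_lt_one (norm_nonneg p) hp).mul_left
        (‖c‖ * (1 - ‖c‖)⁻¹)) fun i => ?_
      rw [div_eq_mul_inv, norm_mul, norm_mul, norm_pow, mul_right_comm]
      gcongr
      refine norm_inv_one_sub_le ?_ hc
      rw [norm_mul, norm_pow]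
      exact mul_le_of_le_one_right (norm_nonneg _) (pow_le_one₀ (norm_nonneg _) hp.le)
    exact (aux y hy).sub (aux _ hby)
  have h3 : Tendsto (fun N => ∑ i ∈ Finset.range N,
      (y * p ^ i / (1 - y * p ^ i) - b * y * p ^ i / (1 - b * y * p ^ i))) atTop
      (𝓝 (∑' n, qGaussDeriv b p y n)) := by
    have := hlim.const_sub (∑' n, qGaussDeriv b p y n)
    rw [sub_zero] at this
    refine this.congr fun N => ?_
    rw [hS N]; ring
  rw [(hsum.hasSum_iff_tendsto_nat.2 h3).tsum_eq]
  exact (summable_qGaussDeriv hp hy hby).hasSum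

end lambert

/-! ### Expansion of well-poised quotients -/

section expansion

variable {a p x : ℂ}

/-- Reversing the product, `1 - a x p^{-j} = (-a p^{-j}) (x - a⁻¹ p^j)`. -/
lemma qPoch_mul_inv_pow (ha : a ≠ 0) (hp : p ≠ 0) (x : ℂ) (n : ℕ) :
    qPoch (a * p * x * (p ^ n)⁻¹) p n =
      (∏ j ∈ Finset.range n, (-a / p ^ j)) * qNum a⁻¹ x p n := by
  rw [qPoch, ← Finset.prod_range_reflect, qNum, ← Finset.prod_mul_distrib]
  refine Finset.prod_congr rfl fun j hj => ?_
  obtain ⟨i, rfl⟩ : ∃ i, n = j + i + 1 := ⟨n - j - 1, by have := Finset.mem_range.1 hj; omega⟩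
  rw [show j + i + 1 - 1 - j = i by omega, pow_succ, pow_add]
  field_simp
  ring

lemma qNum_one (b p : ℂ) (n : ℕ) : qNum b 1 p n = qPoch b p n := rfl

/-- The factor `(1 - a p^{2k}) (a; p)_k / ((1 - a) (p; p)_k)` of very-well-poised series. -/
noncomputable def veryWellPoised (a p : ℂ) (k : ℕ) : ℂ :=
  (1 - a * p ^ (2 * k)) * qPoch a p k / ((1 - a) * qPoch p p k)

/-- This evaluates the `y`-part of the `₆φ₅` summand at `y = p^{-n}`. Passing from `k` to `k + 1`
rests on `1 - a p^{-m} = -a p^{-m} (1 - a⁻¹ p^m)`, which trades a factor of the denominator for one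
of `(a⁻¹; p)_n`. -/
lemma qNum_inv_pow_mul (ha : a ≠ 0) (hp : p ≠ 0) (n k m : ℕ) (hn : n = k + m)
    (hy : ∀ j : ℕ, a * p * (p ^ n)⁻¹ * p ^ j ≠ 1) :
    qNum 1 (p ^ n)⁻¹ p k / qPoch (a * p * (p ^ n)⁻¹) p k *
        (∏ j ∈ Finset.range k, (-a * p ^ (j + 1))) * qPoch a⁻¹ p n =
      qPoch (p ^ n) p k * qPoch a⁻¹ p m := by
  induction k generalizing m with
  | zero => simp [hn]
  | succ k ih =>
    have h := ih (m + 1) (by omega)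
    have n1 : 1 - a * p * (p ^ n)⁻¹ * p ^ k ≠ 0 := sub_ne_zero.2 (hy k).symm
    have e : ((p ^ n)⁻¹ - 1 * p ^ k) * (-a * p ^ (k + 1)) =
        (1 - a * p * (p ^ n)⁻¹ * p ^ k) * (1 - p ^ n * p ^ k) / (1 - a⁻¹ * p ^ m) := by
      have e1 : 1 - a * p * (p ^ n)⁻¹ * p ^ k = -(a * (p ^ m)⁻¹) * (1 - a⁻¹ * p ^ m) := by
        rw [hn, pow_add, pow_succ]
        field_simp
        ring
      have n2 : 1 - a⁻¹ * p ^ m ≠ 0 := by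
        rintro h0
        rw [e1, h0, mul_zero] at n1
        exact n1 rfl
      rw [e1, mul_right_comm, mul_div_assoc, div_self n2, hn, pow_add, pow_add, pow_one]
      field_simp
    have n2 : 1 - a⁻¹ * p ^ m ≠ 0 := by
      intro h0
      have : a⁻¹ * p ^ m = 1 := (sub_eq_zero.1 h0).symm
      apply hy k
      rw [hn, pow_add, pow_succ]
      have : p ^ m = a := by field_simp at this; exact this
      rw [this]
      field_simp
    rw [qPoch_succ a⁻¹] at h
    rw [qNum_succ, qPoch_succ, Finset.prod_range_succ, qPoch_succ]
    calc _ = (qNum 1 (p ^ n)⁻¹ p k / qPoch (a * p * (p ^ n)⁻¹) p k *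
          (∏ j ∈ Finset.range k, (-a * p ^ (j + 1))) * qPoch a⁻¹ p n) *
            (((p ^ n)⁻¹ - 1 * p ^ k) * (-a * p ^ (k + 1)) / (1 - a * p * (p ^ n)⁻¹ * p ^ k)) := by
          simp only [div_eq_mul_inv, mul_inv]; ring
      _ = _ := by
        rw [h, e]
        generalize 1 - a * p * (p ^ n)⁻¹ * p ^ k = v at *
        generalize 1 - a⁻¹ * p ^ m = u at *
        field_simp

/-- Expansion of a well-poised quotient in the basis `(ρ; p)_k / (a p / ρ; p)_k`, `x = 1 / ρ`. -/
lemma qNum_div_qPoch_expansion (ha : a ≠ 0) (hp0 : p ≠ 0) (hp : ∀ j : ℕ, p * p ^ j ≠ 1)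
    (ha1 : ∀ j : ℕ, a * p ^ j ≠ 1) (hx : ∀ j : ℕ, a * p * x * p ^ j ≠ 1)
    (hb : ∀ j : ℕ, a⁻¹ * p ^ j ≠ 1) (n : ℕ) :
    qNum a⁻¹ x p n / qPoch (a * p * x) p n =
      ∑ k ∈ Finset.range (n + 1), veryWellPoised a p k * (qNum 1 x p k / qPoch (a * p * x) p k) *
        (qPoch (p ^ n) p k * qPoch p p n * qPoch a⁻¹ p (n - k) /
          (qPoch p p (n - k) * qPoch (a * p) p (n + k))) := by
  -- The number `a p^{j+1-n}` is `a p^i` when the exponent is nonnegative; otherwise its inverse is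
  -- `a⁻¹ p^i`.
  have hy : ∀ j : ℕ, a * p * (p ^ n)⁻¹ * p ^ j ≠ 1 := fun j h => by
    rcases le_or_gt n (j + 1) with hj | hj
    · obtain ⟨i, hi⟩ := Nat.exists_eq_add_of_le hj
      apply ha1 i
      rw [← h]
      have : p * p ^ j = p ^ n * p ^ i := by rw [← pow_succ', hi, pow_add]
      rw [mul_right_comm, mul_assoc a, this]
      field_simp
    · obtain ⟨i, rfl⟩ : ∃ i, n = j + 1 + i := ⟨n - (j + 1), by omega⟩
      apply hb i
      rw [← inv_inj, inv_one, mul_inv, inv_inv, ← h, pow_add, pow_succ]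
      field_simp
  have h := sixPhiFive hp ha1 hx hy n
  have hD : ∏ j ∈ Finset.range n, (-a / p ^ j) ≠ 0 :=
    Finset.prod_ne_zero_iff.2 fun j _ => div_ne_zero (neg_ne_zero.2 ha) (pow_ne_zero _ hp0)
  have e1 := qPoch_mul_inv_pow ha hp0 1 n
  rw [mul_one, qNum_one] at e1
  rw [qPoch_mul_inv_pow ha hp0, e1] at h
  have n1 : qPoch p p n ≠ 0 := qPoch_ne_zero fun j _ => hp j
  have n2 : qPoch a⁻¹ p n ≠ 0 := qPoch_ne_zero fun j _ => hb j
  have n3 : qPoch (a * p * x) p n ≠ 0 := qPoch_ne_zero fun j _ => hx j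
  have h2 : qNum a⁻¹ x p n / qPoch (a * p * x) p n = qPoch p p n * qPoch a⁻¹ p n *
      (((∏ j ∈ Finset.range n, (-a / p ^ j)) * qNum a⁻¹ x p n) /
        (qPoch p p n * qPoch (a * p * x) p n *
          ((∏ j ∈ Finset.range n, (-a / p ^ j)) * qPoch a⁻¹ p n))) := by
    clear h e1
    generalize ∏ j ∈ Finset.range n, (-a / p ^ j) = D at *
    generalize qPoch a⁻¹ p n = B at *
    field_simp
  rw [h2, ← h, Finset.mul_sum]
  refine Finset.sum_congr rfl fun k hk => ?_
  have hk' : k ≤ n := Nat.lt_succ_iff.1 (Finset.mem_range.1 hk)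
  have h3 := qNum_inv_pow_mul ha hp0 n k (n - k) (by omega) hy
  rw [wellPoised, veryWellPoised]
  calc _ = (1 - a * p ^ (2 * k)) * qPoch a p k / ((1 - a) * qPoch p p k) *
        (qNum 1 x p k / qPoch (a * p * x) p k) * (qPoch p p n * (qNum 1 (p ^ n)⁻¹ p k /
          qPoch (a * p * (p ^ n)⁻¹) p k * (∏ j ∈ Finset.range k, (-a * p ^ (j + 1))) *
            qPoch a⁻¹ p n) / (qPoch p p (n - k) * qPoch (a * p) p (n + k))) := by
        simp only [div_eq_mul_inv, mul_inv]; ring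
    _ = _ := by rw [h3]; ring

/-- The `k = 0` term is split off because it feeds the Lambert series. In the others `1 - p^{n+1}`
cancels through `(p; p)_n (p^{n+1}; p)_{k+1} = (p; p)_{n+k+1}`, leaving the `q`-Gauss summand with
`N = 2k + 1` and index `n - k`. -/
lemma qNum_div_qPoch_succ_expansion (ha : a ≠ 0) (hp0 : p ≠ 0) (hp : ∀ j : ℕ, p * p ^ j ≠ 1)
    (ha1 : ∀ j : ℕ, a * p ^ j ≠ 1) (hx : ∀ j : ℕ, a * p * x * p ^ j ≠ 1)
    (hb : ∀ j : ℕ, a⁻¹ * p ^ j ≠ 1) (n : ℕ) :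
    qNum a⁻¹ x p (n + 1) / (qPoch (a * p * x) p (n + 1) * (1 - p ^ (n + 1))) =
      qPoch a⁻¹ p (n + 1) / (qPoch (a * p) p (n + 1) * (1 - p ^ (n + 1))) +
      ∑ k ∈ Finset.range (n + 1), veryWellPoised a p (k + 1) *
        (qNum 1 x p (k + 1) / qPoch (a * p * x) p (k + 1)) *
        (qPoch a⁻¹ p (n - k) * qPoch p p (2 * k + 1 + (n - k)) /
          (qPoch p p (n - k) * qPoch (a * p) p (2 * k + 1 + 1 + (n - k)))) := by
  have n0 : 1 - p ^ (n + 1) ≠ 0 := by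
    rw [pow_succ']; exact sub_ne_zero.2 (hp n).symm
  have n1 : 1 - a ≠ 0 := sub_ne_zero.2 (by simpa using (ha1 0).symm)
  have n2 : qPoch p p (n + 1) ≠ 0 := qPoch_ne_zero fun j _ => hp j
  rw [← div_div, qNum_div_qPoch_expansion ha hp0 hp ha1 hx hb, Finset.sum_range_succ', add_div,
    add_comm, Finset.sum_div]
  congr 1
  · simp only [veryWellPoised, mul_zero, pow_zero, mul_one, qPoch_zero, qNum_zero, div_one,
      Nat.sub_zero, add_zero, one_mul, div_self n1]
    rw [mul_div_mul_left _ _ n2, div_div]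
  · refine Finset.sum_congr rfl fun k hk => ?_
    have hk' : k ≤ n := Nat.lt_succ_iff.1 (Finset.mem_range.1 hk)
    rw [show n + 1 - (k + 1) = n - k by omega, show 2 * k + 1 + (n - k) = n + (k + 1) by omega,
      show 2 * k + 1 + 1 + (n - k) = n + 1 + (k + 1) by omega, qPoch_add p p n (k + 1),
      qPoch_succ p p n, ← pow_succ']
    field_simp

end expansion

/-! ### The transformation inside `|a² p| < 1` -/

section transformation

variable {a p x : ℂ}

/-- The summand of the well-poised `₂φ₁` derivative, with `x = 1 / ρ`. -/
noncomputable def wellPoisedTerm (a p x : ℂ) (n : ℕ) : ℂ :=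
  qNum a⁻¹ x p (n + 1) / (qPoch (a * p * x) p (n + 1) * (1 - p ^ (n + 1))) *
    (a ^ 2 * p) ^ (n + 1)

/-- The summand of the very-well-poised series, with `x = 1 / ρ`. -/
noncomputable def veryWellPoisedTerm (a p x : ℂ) (k : ℕ) : ℂ :=
  veryWellPoised a p (k + 1) * (qNum 1 x p (k + 1) / qPoch (a * p * x) p (k + 1)) *
    (qPoch p p (2 * k + 1) / qPoch (a ^ 2 * p) p (2 * k + 1 + 1)) * (a ^ 2 * p) ^ (k + 1)

/-- The summand of the Lambert series. -/
noncomputable def lambertTerm (a p : ℂ) (i : ℕ) : ℂ :=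
  a ^ 2 * p * p ^ i / (1 - a ^ 2 * p * p ^ i) - a * p * p ^ i / (1 - a * p * p ^ i)

lemma norm_mul_lt_one (ha : 1 < ‖a‖) (hz : ‖a ^ 2 * p‖ ≤ 1) (hp : p ≠ 0) : ‖a * p‖ < 1 := by
  have h1 : ‖a ^ 2 * p‖ = ‖a‖ * ‖a * p‖ := by rw [← norm_mul]; ring_nf
  have h2 : 0 < ‖a * p‖ := norm_pos_iff.2 (mul_ne_zero (norm_pos_iff.1 (by linarith)) hp)
  nlinarith

lemma mul_pow_ne_one_of_one_lt (ha : 1 < ‖a‖) (hp : ‖p‖ < 1) (hap : ‖a * p‖ < 1) (j : ℕ) :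
    a * p ^ j ≠ 1 := by
  cases j with
  | zero => rintro h; simp at h; simp [h] at ha
  | succ j => rw [pow_succ', ← mul_assoc]; exact mul_pow_ne_one hp hap j

lemma exists_norm_veryWellPoised_le (hp : ‖p‖ < 1) {R δ : ℝ} (hδ : 0 < δ) :
    ∃ C : ℝ, 0 < C ∧ ∀ a : ℂ, ‖a‖ ≤ R → δ ≤ ‖1 - a‖ → ∀ k, ‖veryWellPoised a p k‖ ≤ C := by
  obtain ⟨C, hC, hC'⟩ := exists_norm_qPoch_le hp (abs_nonneg R)
  obtain ⟨D, hD, hD'⟩ := exists_norm_qPoch_inv_le hp (norm_nonneg _) hp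
  refine ⟨(1 + |R|) * C * (δ⁻¹ * D), by positivity, fun a ha hδa k => ?_⟩
  have ha' : ‖a‖ ≤ |R| := ha.trans (le_abs_self R)
  rw [veryWellPoised, div_eq_mul_inv, mul_inv, norm_mul, norm_mul, norm_mul]
  gcongr
  · calc ‖1 - a * p ^ (2 * k)‖ ≤ 1 + ‖a‖ * ‖p‖ ^ (2 * k) := by
          simpa using norm_sub_le 1 (a * p ^ (2 * k))
      _ ≤ 1 + |R| * 1 := by gcongr; exact pow_le_one₀ (norm_nonneg _) hp.le
      _ = _ := by rw [mul_one]
  · exact hC' _ ha' _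
  · rw [norm_inv]; exact inv_anti₀ hδ hδa
  · exact hD' _ le_rfl _

/-- An absolutely convergent double series is summed in two ways: its rows are `q`-Gauss sums with
`b = a⁻¹`, `y = a² p`, and its antidiagonals restore the expansion of the well-poised summand
without the `k = 0` term. -/
theorem hasSum_transformation (hp0 : p ≠ 0) (hp : ‖p‖ < 1) (ha : 1 < ‖a‖)
    (hz : ‖a ^ 2 * p‖ < 1) (hx : ‖x‖ ≤ 1) :
    ∃ τ, HasSum (veryWellPoisedTerm a p x) τ ∧
      HasSum (wellPoisedTerm a p x) (∑' i, lambertTerm a p i + τ) := by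
  have ha0 : a ≠ 0 := norm_pos_iff.1 (by linarith)
  have hap := norm_mul_lt_one ha hz.le hp0
  have hapx : ‖a * p * x‖ < 1 := by
    rw [norm_mul]; exact mul_lt_one_of_nonneg_of_lt_one_left (norm_nonneg _) hap hx
  have hb : ‖a⁻¹‖ < 1 := by rw [norm_inv]; exact inv_lt_one_of_one_lt₀ ha
  have hbz : a⁻¹ * (a ^ 2 * p) = a * p := by field_simp
  set z := a ^ 2 * p with hzdef
  have ha1 := mul_pow_ne_one_of_one_lt ha hp hap
  have ha2 : 0 < ‖1 - a‖ := norm_pos_iff.2 (sub_ne_zero.2 (by simpa using (ha1 0).symm))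
  have hgauss := fun N => hasSum_qGauss (b := a⁻¹) hp hz (by rwa [hbz]) N
  rw [hbz] at hgauss
  let F : ℕ × ℕ → ℂ := fun i => veryWellPoised a p (i.1 + 1) *
    (qNum 1 x p (i.1 + 1) / qPoch (a * p * x) p (i.1 + 1)) * z ^ (i.1 + 1) *
    (qPoch a⁻¹ p i.2 * qPoch p p (2 * i.1 + 1 + i.2) /
      (qPoch p p i.2 * qPoch (a * p) p (2 * i.1 + 1 + 1 + i.2)) * z ^ i.2)
  -- All shifted factorials stay bounded, so the powers of `z` alone give the convergence.
  have hF : Summable F := by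
    obtain ⟨C₁, h1, h1'⟩ := exists_norm_veryWellPoised_le (R := ‖a‖) hp ha2
    obtain ⟨C₂, h2, h2'⟩ := exists_norm_qNum_le hp one_pos
    obtain ⟨C₃, h3, h3'⟩ := exists_norm_qPoch_inv_le hp (norm_nonneg _) hapx
    obtain ⟨C₄, h4, h4'⟩ := exists_norm_qPoch_le hp zero_le_one
    obtain ⟨C₅, h5, h5'⟩ := exists_norm_qPoch_inv_le hp (norm_nonneg _) hp
    obtain ⟨C₆, h6, h6'⟩ := exists_norm_qPoch_inv_le hp (norm_nonneg _) hap
    have hg := summable_geometric_of_lt_one (norm_nonneg z) hz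
    have hg' := (summable_nat_add_iff 1).2 hg
    refine .of_norm_bounded ((hg'.mul_of_nonneg hg (fun _ => by positivity)
      fun _ => by positivity).mul_left (C₁ * (C₂ * C₃) * (C₄ * C₄ * (C₅ * C₆)))) fun i => ?_
    have e : F i = veryWellPoised a p (i.1 + 1) *
        (qNum 1 x p (i.1 + 1) * (qPoch (a * p * x) p (i.1 + 1))⁻¹) *
        (qPoch a⁻¹ p i.2 * qPoch p p (2 * i.1 + 1 + i.2) *
          ((qPoch p p i.2)⁻¹ * (qPoch (a * p) p (2 * i.1 + 1 + 1 + i.2))⁻¹)) *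
        (z ^ (i.1 + 1) * z ^ i.2) := by
      simp only [F, div_eq_mul_inv, mul_inv]; ring
    rw [e]
    simp only [norm_mul, norm_pow]
    have b2 : ‖qNum 1 x p (i.1 + 1)‖ ≤ C₂ := by
      simpa using h2' 1 x (by simp) hx (i.1 + 1)
    gcongr
    · exact h1' _ le_rfl le_rfl _
    · exact h3' _ le_rfl _
    · exact h4' _ hb.le _
    · exact h4' _ hp.le _
    · exact h5' _ le_rfl _
    · exact h6' _ le_rfl _
  have hrow : ∀ k, HasSum (fun m => F (k, m)) (veryWellPoisedTerm a p x k) := fun k => by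
    have := (hgauss (2 * k + 1)).mul_left (veryWellPoised a p (k + 1) *
      (qNum 1 x p (k + 1) / qPoch (a * p * x) p (k + 1)) * z ^ (k + 1))
    convert this using 1
    · rfl
    · rw [veryWellPoisedTerm]
      ring
  have hT := hF.hasSum.prod_fiberwise hrow
  refine ⟨_, hT, ?_⟩
  have hA := (Finset.HasAntidiagonal.sigmaAntidiagonalEquivProd.hasSum_iff.2 hF.hasSum).sigma
    (fun n => hasSum_fintype _)
  have hL := hasSum_qGaussDeriv (b := a⁻¹) hp hz (by rwa [hbz])
  have := hL.add hA
  convert this using 1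
  · ext n
    have hx' : ∀ j : ℕ, a * p * x * p ^ j ≠ 1 := mul_pow_ne_one hp hapx
    rw [wellPoisedTerm, qNum_div_qPoch_succ_expansion ha0 hp0 (mul_pow_ne_one hp hp) ha1 hx'
      (mul_pow_ne_one hp hb), add_mul, qGaussDeriv, hbz, ← hzdef]
    congr 1
    have e := Finset.sum_attach (Finset.HasAntidiagonal.antidiagonal n) F
    rw [Finset.univ_eq_attach]
    simp only [Function.comp_def, Finset.HasAntidiagonal.sigmaAntidiagonalEquivProd_apply]
    rw [e, Finset.Nat.sum_antidiagonal_eq_sum_range_succ_mk, Finset.sum_mul]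
    refine Finset.sum_congr rfl fun k hk => ?_
    have hk' : k ≤ n := Nat.lt_succ_iff.1 (Finset.mem_range.1 hk)
    simp only [F]
    rw [show n + 1 = k + 1 + (n - k) by omega, pow_add z (k + 1)]
    ring
  · rw [hbz]
    rfl

end transformation

/-! ### Passage to the boundary point `a² p = -1` -/

section boundary

variable {a p x : ℂ}

@[fun_prop]
lemma continuous_qPoch (p : ℂ) (n : ℕ) : Continuous fun c => qPoch c p n := by
  unfold qPoch; fun_prop

@[fun_prop]
lemma continuous_qNum (x p : ℂ) (n : ℕ) : Continuous fun b => qNum b x p n := by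
  unfold qNum; fun_prop

/-- The parameters `a'` near `a` for which the series are dominated uniformly. -/
structure IsDominated (a p : ℂ) (δ : ℝ) (a' : ℂ) : Prop where
  one_le : 1 ≤ ‖a'‖
  le : ‖a'‖ ≤ ‖a‖
  dist : δ ≤ ‖1 - a'‖
  real : ∃ r : ℝ, 0 ≤ r ∧ r ≤ 1 ∧ a' ^ 2 * p = -r

lemma IsDominated.norm_le {δ : ℝ} {a' : ℂ} (h : IsDominated a p δ a') : ‖a' ^ 2 * p‖ ≤ 1 := by
  obtain ⟨r, h0, h1, e⟩ := h.real
  rwa [e, norm_neg, Complex.norm_real, Real.norm_of_nonneg h0]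

/-- Only `i = 0` is delicate, since `|a'² p|` may equal `1`; there `a'² p = -r` makes the
denominator `1 + r ≥ 1`. -/
lemma IsDominated.norm_inv_le (hp : ‖p‖ < 1) {δ : ℝ} {a' : ℂ} (h : IsDominated a p δ a') (i : ℕ) :
    ‖(1 - a' ^ 2 * p * p ^ i)⁻¹‖ ≤ (1 - ‖p‖)⁻¹ := by
  have hp1 : 0 < 1 - ‖p‖ := by linarith
  cases i with
  | zero =>
    obtain ⟨r, h0, h1, e⟩ := h.real
    rw [e, pow_zero, mul_one, sub_neg_eq_add, norm_inv]
    refine inv_anti₀ hp1 ?_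
    rw [← Complex.ofReal_one, ← Complex.ofReal_add, Complex.norm_real,
      Real.norm_of_nonneg (by positivity)]
    linarith [norm_nonneg p]
  | succ i =>
    refine norm_inv_one_sub_le ?_ hp
    rw [norm_mul]
    exact (mul_le_of_le_one_left (norm_nonneg _) h.norm_le).trans (norm_pow_succ_le hp i)

lemma exists_norm_wellPoisedTerm_le (hp : ‖p‖ < 1) (hap : ‖a * p‖ < 1) {s : ℝ} (hs : 0 < s)
    (hs1 : s < 1) (hx : ‖x‖ ≤ s) (δ : ℝ) :
    ∃ C : ℝ, ∀ a', IsDominated a p δ a' → ∀ n, ‖wellPoisedTerm a' p x n‖ ≤ C * s ^ n := by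
  obtain ⟨C, hC, hC'⟩ := exists_norm_qNum_le hp hs
  obtain ⟨D, hD, hD'⟩ := exists_norm_qPoch_inv_le hp (norm_nonneg _) hap
  have hp1 : 0 < 1 - ‖p‖ := by linarith
  refine ⟨C * (D * (1 - ‖p‖)⁻¹), fun a' h n => ?_⟩
  rw [wellPoisedTerm, div_eq_mul_inv, mul_inv, norm_mul, norm_mul, norm_mul, norm_pow]
  have h1 : ‖qNum a'⁻¹ x p (n + 1)‖ ≤ C * s ^ n := by
    refine (hC' _ x (by rw [norm_inv]; exact inv_le_one_of_one_le₀ h.one_le) hx _).trans ?_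
    gcongr ?_ * ?_
    exact pow_le_pow_of_le_one hs.le hs1.le n.le_succ
  have h2 : ‖(qPoch (a' * p * x) p (n + 1))⁻¹‖ ≤ D := by
    refine hD' _ ?_ _
    rw [norm_mul, norm_mul, norm_mul]
    exact mul_le_of_le_one_right (by positivity) (hx.trans hs1.le) |>.trans
      (mul_le_mul_of_nonneg_right h.le (norm_nonneg _))
  have h3 : ‖(1 - p ^ (n + 1))⁻¹‖ ≤ (1 - ‖p‖)⁻¹ :=
    norm_inv_one_sub_le (norm_pow_succ_le hp n) hp
  calc _ ≤ C * s ^ n * (D * (1 - ‖p‖)⁻¹) * 1 := by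
        gcongr
        exact pow_le_one₀ (norm_nonneg _) h.norm_le
    _ = _ := by ring

lemma exists_norm_veryWellPoisedTerm_le (hp : ‖p‖ < 1) (hap : ‖a * p‖ < 1) {s : ℝ} (hs : 0 < s)
    (hs1 : s < 1) (hx : ‖x‖ ≤ s) {δ : ℝ} (hδ : 0 < δ) :
    ∃ C : ℝ, ∀ a', IsDominated a p δ a' → ∀ n, ‖veryWellPoisedTerm a' p x n‖ ≤ C * s ^ n := by
  obtain ⟨C, hC, hC'⟩ := exists_norm_qNum_le hp hs
  obtain ⟨D, hD, hD'⟩ := exists_norm_qPoch_inv_le hp (norm_nonneg _) hap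
  obtain ⟨E, hE, hE'⟩ := exists_norm_veryWellPoised_le (R := ‖a‖) hp hδ
  obtain ⟨F, hF, hF'⟩ := exists_norm_qPoch_le hp (norm_nonneg p)
  obtain ⟨G, hG, hG'⟩ := exists_norm_qPoch_inv_le hp (norm_nonneg _) hp
  have hp1 : 0 < 1 - ‖p‖ := by linarith
  refine ⟨E * (C * D) * (F * ((1 - ‖p‖)⁻¹ * G)), fun a' h n => ?_⟩
  -- The factor `1 - a'² p` is detached: the remaining factorial starts at `a'² p²`, of norm at most
  -- `‖p‖ < 1`, where the uniform inverse bound applies.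
  rw [veryWellPoisedTerm, qPoch_succ' (a' ^ 2 * p), div_eq_mul_inv, div_eq_mul_inv, mul_inv,
    norm_mul, norm_mul, norm_mul, norm_mul, norm_mul, norm_mul, norm_pow]
  have h1 : ‖qNum 1 x p (n + 1)‖ ≤ C * s ^ n := by
    refine (hC' _ x (by simp) hx _).trans ?_
    gcongr ?_ * ?_
    exact pow_le_pow_of_le_one hs.le hs1.le n.le_succ
  have h2 : ‖(qPoch (a' * p * x) p (n + 1))⁻¹‖ ≤ D := by
    refine hD' _ ?_ _
    rw [norm_mul, norm_mul, norm_mul]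
    exact mul_le_of_le_one_right (by positivity) (hx.trans hs1.le) |>.trans
      (mul_le_mul_of_nonneg_right h.le (norm_nonneg _))
  have h3 : ‖(1 - a' ^ 2 * p)⁻¹‖ ≤ (1 - ‖p‖)⁻¹ := by simpa using h.norm_inv_le hp 0
  have h4 : ‖(qPoch (a' ^ 2 * p * p) p (2 * n + 1))⁻¹‖ ≤ G := by
    refine hG' _ ?_ _
    rw [norm_mul]
    exact mul_le_of_le_one_left (norm_nonneg _) h.norm_le
  calc _ ≤ E * (C * s ^ n * D) * (F * ((1 - ‖p‖)⁻¹ * G)) * 1 := by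
        gcongr
        · exact hE' _ h.le h.dist _
        · exact hF' _ le_rfl _
        · exact pow_le_one₀ (norm_nonneg _) h.norm_le
    _ = _ := by ring

lemma exists_norm_lambertTerm_le (hp : ‖p‖ < 1) (hap : ‖a * p‖ < 1) (δ : ℝ) :
    ∃ C : ℝ, ∀ a', IsDominated a p δ a' → ∀ n, ‖lambertTerm a' p n‖ ≤ C * ‖p‖ ^ n := by
  have hp1 : 0 < 1 - ‖p‖ := by linarith
  have hap1 : 0 < 1 - ‖a * p‖ := by linarith
  refine ⟨1 * (1 - ‖p‖)⁻¹ + 1 * (1 - ‖a * p‖)⁻¹, fun a' h n => ?_⟩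
  have h0 : ‖a' * p‖ ≤ ‖a * p‖ := by
    rw [norm_mul, norm_mul]; exact mul_le_mul_of_nonneg_right h.le (norm_nonneg _)
  rw [lambertTerm]
  refine (norm_sub_le _ _).trans ?_
  rw [div_eq_mul_inv, div_eq_mul_inv, norm_mul, norm_mul, norm_mul (_ * _) _⁻¹,
    norm_mul (a' * p), norm_pow, add_mul, mul_right_comm, mul_right_comm ‖a' * p‖]
  gcongr
  · exact h.norm_le
  · exact h.norm_inv_le hp n
  · exact h0.trans hap.le
  · refine norm_inv_one_sub_le ?_ hap
    rw [norm_mul, norm_pow]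
    exact (mul_le_of_le_one_right (norm_nonneg _) (pow_le_one₀ (norm_nonneg _) hp.le)).trans h0

lemma qPoch_succ_ne_zero_of_eq (hp : ‖p‖ < 1) (haz : a ^ 2 * p = -1) (n : ℕ) :
    qPoch (a ^ 2 * p) p (n + 1) ≠ 0 := by
  rw [qPoch_succ', haz]
  refine mul_ne_zero (by norm_num) (qPoch_ne_zero_of_norm_lt hp (by simpa using hp) n)

lemma continuousAt_wellPoisedTerm (hp : ‖p‖ < 1) (ha : a ≠ 0) (hapx : ‖a * p * x‖ < 1) (n : ℕ) :
    ContinuousAt (fun a' => wellPoisedTerm a' p x n) a := by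
  unfold wellPoisedTerm
  refine (ContinuousAt.div ?_ ?_ ?_).mul (by fun_prop)
  · exact (continuous_qNum x p (n + 1)).continuousAt.comp (continuousAt_inv₀ ha)
  · fun_prop
  · exact mul_ne_zero (qPoch_ne_zero_of_norm_lt hp hapx _) (one_sub_pow_succ_ne_zero hp n)

lemma continuousAt_veryWellPoisedTerm (hp : ‖p‖ < 1) (ha : a ≠ 1) (hapx : ‖a * p * x‖ < 1)
    (haz : a ^ 2 * p = -1) (n : ℕ) :
    ContinuousAt (fun a' => veryWellPoisedTerm a' p x n) a := by
  unfold veryWellPoisedTerm veryWellPoised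
  refine (((ContinuousAt.div (by fun_prop) (by fun_prop) ?_).mul
    (ContinuousAt.div (by fun_prop) (by fun_prop) ?_)).mul
    (ContinuousAt.div (by fun_prop) (by fun_prop) ?_)).mul (by fun_prop)
  · exact mul_ne_zero (sub_ne_zero.2 ha.symm) (qPoch_ne_zero_of_norm_lt hp hp _)
  · exact qPoch_ne_zero_of_norm_lt hp hapx _
  · exact qPoch_succ_ne_zero_of_eq hp haz _

lemma continuousAt_lambertTerm (hp : ‖p‖ < 1) (hap : ‖a * p‖ < 1) (haz : a ^ 2 * p = -1) (n : ℕ) :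
    ContinuousAt (fun a' => lambertTerm a' p n) a := by
  unfold lambertTerm
  refine (ContinuousAt.div (by fun_prop) (by fun_prop) ?_).sub
    (ContinuousAt.div (by fun_prop) (by fun_prop) ?_)
  · have := qPoch_succ_ne_zero_of_eq hp haz n
    rw [qPoch_succ] at this
    exact right_ne_zero_of_mul this
  · exact sub_ne_zero.2 (mul_pow_ne_one hp hap n).symm

/-- The transformation on the circle `|a² p| = 1`, at `a² p = -1`. -/
theorem hasSum_transformation_of_eq_neg_one (hp0 : p ≠ 0) (hp : ‖p‖ < 1) (haz : a ^ 2 * p = -1)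
    (hx : ‖x‖ < 1) :
    ∃ τ, HasSum (veryWellPoisedTerm a p x) τ ∧
      HasSum (wellPoisedTerm a p x) (∑' i, lambertTerm a p i + τ) := by
  have hnz : ‖a‖ ^ 2 * ‖p‖ = 1 := by
    rw [← norm_pow, ← norm_mul, haz, norm_neg, norm_one]
  have ha : 1 < ‖a‖ := by
    by_contra! h
    have h1 : ‖a‖ ^ 2 ≤ 1 := pow_le_one₀ (norm_nonneg _) h
    nlinarith [norm_nonneg p]
  have hap : ‖a * p‖ < 1 := norm_mul_lt_one ha (by simp [haz]) hp0
  have hapx : ‖a * p * x‖ < 1 := by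
    rw [norm_mul]; exact mul_lt_one_of_nonneg_of_lt_one_left (norm_nonneg _) hap hx.le
  have ha0 : a ≠ 0 := norm_pos_iff.1 (by linarith)
  have ha1 : a ≠ 1 := fun h => by simp [h] at ha
  obtain ⟨s, hxs, hs1⟩ := exists_between hx
  have hs0 : 0 < s := (norm_nonneg x).trans_lt hxs
  set δ := (‖a‖ - 1) / 2 with hδdef
  have hδ : 0 < δ := by linarith
  -- The lower bound on `r` keeps `|r a|` at or above the midpoint of `1` and `|a|`, so `|1 - r a| ≥
  -- |r a| - 1 ≥ δ`.
  have hdom : ∀ r : ℝ, (1 + ‖a‖) / (2 * ‖a‖) ≤ r → r ≤ 1 → IsDominated a p δ (r * a) := by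
    intro r hr hr1
    have hr0 : 0 < r := lt_of_lt_of_le (by positivity) hr
    have hn : ‖(r : ℂ) * a‖ = r * ‖a‖ := by
      rw [norm_mul, Complex.norm_real, Real.norm_of_nonneg hr0.le]
    have hr2 : (1 + ‖a‖) / 2 ≤ r * ‖a‖ := by
      rw [div_le_iff₀ (by positivity)] at hr; linarith
    refine ⟨by rw [hn]; linarith, by rw [hn]; nlinarith, ?_, r ^ 2, by positivity,
      pow_le_one₀ hr0.le hr1, ?_⟩
    · have := norm_sub_norm_le ((r : ℂ) * a) 1
      rw [hn, norm_one, norm_sub_rev] at this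
      linarith
    · push_cast; linear_combination (r : ℂ) ^ 2 * haz
  have hr0 : (1 + ‖a‖) / (2 * ‖a‖) < 1 := by
    rw [div_lt_one (by positivity)]; linarith
  have hself : IsDominated a p δ a := by simpa using hdom 1 hr0.le le_rfl
  have hev : ∀ᶠ r : ℝ in 𝓝[<] 1, IsDominated a p δ (r * a) := by
    filter_upwards [Ioo_mem_nhdsLT hr0] with r hr using hdom r hr.1.le hr.2.le
  have hev2 : ∀ᶠ r : ℝ in 𝓝[<] 1, ∑' n, wellPoisedTerm (r * a) p x n =
      ∑' i, lambertTerm (r * a) p i + ∑' n, veryWellPoisedTerm (r * a) p x n := by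
    filter_upwards [Ioo_mem_nhdsLT hr0] with r hr
    have hr1 : 0 < r := lt_trans (by positivity) hr.1
    have hn : ‖(r : ℂ) * a‖ = r * ‖a‖ := by
      rw [norm_mul, Complex.norm_real, Real.norm_of_nonneg hr1.le]
    have h1 : 1 < ‖(r : ℂ) * a‖ := by
      have h3 := hr.1
      rw [div_lt_iff₀ (by positivity)] at h3; rw [hn]; linarith
    have h2 : ‖((r : ℂ) * a) ^ 2 * p‖ < 1 := by
      rw [norm_mul, norm_pow, hn, mul_pow, mul_assoc, hnz, mul_one]
      exact pow_lt_one₀ hr1.le hr.2 two_ne_zero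
    obtain ⟨τ, h3, h4⟩ := hasSum_transformation hp0 hp h1 h2 hx.le
    rw [h4.tsum_eq, h3.tsum_eq]
  have hlim : Tendsto (fun r : ℝ => (r : ℂ) * a) (𝓝[<] 1) (𝓝 a) := by
    have : Tendsto (fun r : ℝ => (r : ℂ) * a) (𝓝 1) (𝓝 (((1 : ℝ) : ℂ) * a)) :=
      Continuous.tendsto (by fun_prop) 1
    rw [Complex.ofReal_one, one_mul] at this
    exact this.mono_left nhdsWithin_le_nhds
  have hsg := summable_geometric_of_lt_one hs0.le hs1
  have hpg := summable_geometric_of_lt_one (norm_nonneg p) hp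
  obtain ⟨C₁, h1⟩ := exists_norm_wellPoisedTerm_le hp hap hs0 hs1 hxs.le δ
  obtain ⟨C₂, h2⟩ := exists_norm_veryWellPoisedTerm_le hp hap hs0 hs1 hxs.le hδ
  obtain ⟨C₃, h3⟩ := exists_norm_lambertTerm_le hp hap δ
  -- Both hypergeometric series are dominated by a multiple of `∑ s^n` with `|x| < s < 1`, and the
  -- Lambert series by a multiple of `∑ ‖p‖^n`.
  have t1 := tendsto_tsum_of_dominated_convergence (hsg.mul_left C₁)
    (fun n => (continuousAt_wellPoisedTerm hp ha0 hapx n).tendsto.comp hlim)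
    (hev.mono fun r hr => h1 _ hr)
  have t2 := tendsto_tsum_of_dominated_convergence (hsg.mul_left C₂)
    (fun n => (continuousAt_veryWellPoisedTerm hp ha1 hapx haz n).tendsto.comp hlim)
    (hev.mono fun r hr => h2 _ hr)
  have t3 := tendsto_tsum_of_dominated_convergence (hpg.mul_left C₃)
    (fun n => (continuousAt_lambertTerm hp hap haz n).tendsto.comp hlim)
    (hev.mono fun r hr => h3 _ hr)
  have heq := tendsto_nhds_unique (t1.congr' hev2) (t3.add t2)
  refine ⟨_, (Summable.of_norm_bounded (hsg.mul_left C₂) (h2 a hself)).hasSum, ?_⟩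
  rw [← heq]
  exact (Summable.of_norm_bounded (hsg.mul_left C₁) (h1 a hself)).hasSum

end boundary

/-! ### Gauss's product for `ψ` and a theta-type series for `ψ²` -/

section theta

variable {x : ℂ}

lemma norm_sq_lt_one (hx : ‖x‖ < 1) : ‖x ^ 2‖ < 1 := by
  rw [norm_pow]; exact pow_lt_one₀ (norm_nonneg _) hx two_ne_zero

/-- The partial products of `∏ (1 - x^{2k}) / (1 - x^{2k-1})`. -/
noncomputable def psiProd (x : ℂ) (n : ℕ) : ℂ := qPoch (x ^ 2) (x ^ 2) n / qPoch x (x ^ 2) n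

lemma psiProd_ne_zero (hx : ‖x‖ < 1) (n : ℕ) : psiProd x n ≠ 0 :=
  div_ne_zero (qPoch_ne_zero_of_norm_lt (norm_sq_lt_one hx) (norm_sq_lt_one hx) n)
    (qPoch_ne_zero_of_norm_lt (norm_sq_lt_one hx) hx n)

lemma psiProd_succ (x : ℂ) (n : ℕ) :
    psiProd x (n + 1) = psiProd x n * ((1 - x ^ (2 * n + 2)) / (1 - x ^ (2 * n + 1))) := by
  rw [psiProd, psiProd, qPoch_succ, qPoch_succ, mul_div_mul_comm]
  congr 3 <;> ring

/-- The difference of the summands of Shanks' identity for `n + 1` and `n` telescopes in `s`; at `m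
= n` this gives the induction step of `psiProd_finite`. -/
lemma psiProd_partial (hx : ‖x‖ < 1) (n m : ℕ) :
    ∑ s ∈ Finset.range m, (psiProd x (n + 1) / psiProd x s * x ^ (s * (2 * n + 3)) -
        psiProd x n / psiProd x s * x ^ (s * (2 * n + 1))) =
      psiProd x n / psiProd x m * x ^ (m * (2 * n + 1)) * (1 - x ^ (2 * m)) /
        (1 - x ^ (2 * n + 1)) := by
  induction m with
  | zero => simp
  | succ m ih =>
    rw [Finset.sum_range_succ, ih, psiProd_succ x m, psiProd_succ x n]
    have n1 := psiProd_ne_zero hx m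
    have n2 : 1 - x ^ (2 * n + 1) ≠ 0 := one_sub_pow_succ_ne_zero hx _
    have n3 : 1 - x ^ (2 * m + 1) ≠ 0 := one_sub_pow_succ_ne_zero hx _
    have n4 : 1 - x ^ (2 * m + 2) ≠ 0 := one_sub_pow_succ_ne_zero hx _
    rw [show m * (2 * n + 3) = m * (2 * n + 1) + 2 * m by ring,
      show (m + 1) * (2 * n + 1) = m * (2 * n + 1) + (2 * n + 1) by ring,
      show 2 * (m + 1) = 2 * m + 2 by ring, show 2 * n + 2 = 2 * n + 1 + 1 by ring,
      pow_add x (m * (2 * n + 1)), pow_add x (m * (2 * n + 1)), pow_succ x (2 * n + 1)]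
    have e3 : x ^ (2 * m + 1) = x ^ (2 * m) * x := pow_succ _ _
    generalize x ^ (m * (2 * n + 1)) = Z at *
    generalize x ^ (2 * n + 1) = N at *
    generalize 1 - x ^ (2 * m + 2) = d at *
    obtain ⟨u, hu⟩ : ∃ u, u = 1 - x ^ (2 * m + 1) := ⟨_, rfl⟩
    rw [← hu] at n3 ⊢
    rw [e3] at hu
    generalize x ^ (2 * m) = M at *
    field_simp
    rw [hu]
    ring

/-- Shanks' finite form of Gauss's product for `ψ`. -/
lemma psiProd_finite (hx : ‖x‖ < 1) (n : ℕ) :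
    ∑ s ∈ Finset.range n, psiProd x n / psiProd x s * x ^ (s * (2 * n + 1)) =
      ∑ t ∈ Finset.range (2 * n), x ^ (t * (t + 1) / 2) := by
  induction n with
  | zero => simp
  | succ n ih =>
    have h := psiProd_partial hx n n
    rw [Finset.sum_sub_distrib, ih, div_self (psiProd_ne_zero hx n)] at h
    rw [show 2 * (n + 1) = 2 * n + 1 + 1 by ring, Finset.sum_range_succ _ n,
      Finset.sum_range_succ _ (2 * n + 1), Finset.sum_range_succ _ (2 * n)]
    rw [show 2 * n * (2 * n + 1) / 2 = n * (2 * n + 1) by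
        rw [mul_assoc]; exact Nat.mul_div_cancel_left _ two_pos,
      show (2 * n + 1) * (2 * n + 1 + 1) / 2 = n * (2 * n + 1) + (2 * n + 1) by
        rw [show (2 * n + 1) * (2 * n + 1 + 1) = 2 * (n * (2 * n + 1) + (2 * n + 1)) by ring]
        exact Nat.mul_div_cancel_left _ two_pos,
      show 2 * n + 1 + 1 + 1 = 2 * n + 3 by ring, eq_add_of_sub_eq h, psiProd_succ]
    have n1 := psiProd_ne_zero hx n
    have n2 : 1 - x ^ (2 * n + 1) ≠ 0 := one_sub_pow_succ_ne_zero hx _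
    rw [show n * (2 * n + 3) = n * (2 * n + 1) + 2 * n by ring, pow_add x _ (2 * n),
      pow_add x _ (2 * n + 1), show 2 * n + 2 = 2 * n + 1 + 1 by ring, pow_succ x (2 * n + 1)]
    have e3 : x ^ (2 * n + 1) = x ^ (2 * n) * x := pow_succ _ _
    obtain ⟨u, hu⟩ : ∃ u, u = 1 - x ^ (2 * n + 1) := ⟨_, rfl⟩
    rw [← hu] at n2 ⊢
    rw [e3] at hu ⊢
    field_simp
    rw [hu]
    ring

lemma summable_psi (hx : ‖x‖ < 1) : Summable fun t : ℕ => x ^ (t * (t + 1) / 2) := by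
  refine .of_norm_bounded (summable_geometric_of_lt_one (norm_nonneg x) hx) fun t => ?_
  rw [norm_pow]
  refine pow_le_pow_of_le_one (norm_nonneg _) hx.le ?_
  rw [Nat.le_div_iff_mul_le two_pos]
  cases t with
  | zero => simp
  | succ t => gcongr; omega

/-- In Shanks' identity the term `s = 0` is the partial product itself, and the others together are
`O(n |x|^n)`. -/
theorem tendsto_psiProd (hx : ‖x‖ < 1) : Tendsto (psiProd x) atTop (𝓝 (ramanujanPsi x)) := by
  have hB := norm_sq_lt_one hx
  obtain ⟨C, hC, hC'⟩ := exists_norm_qPoch_le hB zero_le_one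
  obtain ⟨D, hD, hD'⟩ := exists_norm_qPoch_inv_le hB (norm_nonneg _) hB
  obtain ⟨E, hE, hE'⟩ := exists_norm_qPoch_inv_le hB (norm_nonneg _) hx
  have h1 : ∀ n, psiProd x (n + 1) = ∑ t ∈ Finset.range (2 * (n + 1)), x ^ (t * (t + 1) / 2) -
      ∑ s ∈ Finset.range n, psiProd x (n + 1) / psiProd x (s + 1) *
        x ^ ((s + 1) * (2 * (n + 1) + 1)) := fun n => by
    rw [← psiProd_finite hx (n + 1), Finset.sum_range_succ']
    simp [psiProd]
  have h2 : Tendsto (fun n => ∑ t ∈ Finset.range (2 * (n + 1)), x ^ (t * (t + 1) / 2)) atTop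
      (𝓝 (ramanujanPsi x)) :=
    (summable_psi hx).hasSum.tendsto_sum_nat.comp
      (tendsto_atTop_mono (fun n => by show n ≤ 2 * (n + 1); omega) tendsto_id)
  have h3 : Tendsto (fun n => ∑ s ∈ Finset.range n, psiProd x (n + 1) / psiProd x (s + 1) *
        x ^ ((s + 1) * (2 * (n + 1) + 1))) atTop (𝓝 0) := by
    have hb : ∀ n : ℕ, ‖∑ s ∈ Finset.range n, psiProd x (n + 1) / psiProd x (s + 1) *
        x ^ ((s + 1) * (2 * (n + 1) + 1))‖ ≤ C * E * (D * C) * (n * ‖x‖ ^ n) := fun n => by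
      refine (norm_sum_le_of_le _ (n := fun _ => C * E * (D * C) * ‖x‖ ^ n) fun s _ => ?_).trans_eq
        (by rw [Finset.sum_const, Finset.card_range, nsmul_eq_mul]; ring)
      rw [psiProd, psiProd, div_eq_mul_inv, inv_div, norm_mul, norm_mul, div_eq_mul_inv,
        div_eq_mul_inv, norm_mul, norm_mul, mul_comm ‖qPoch x (x ^ 2) (s + 1)‖, norm_pow]
      have h3 : ‖x‖ ^ ((s + 1) * (2 * (n + 1) + 1)) ≤ ‖x‖ ^ n :=
        pow_le_pow_of_le_one (norm_nonneg _) hx.le (by nlinarith)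
      gcongr ?_ * ?_ * (?_ * ?_) * ?_
      · exact hC' _ hB.le _
      · exact hE' _ le_rfl _
      · exact hD' _ le_rfl _
      · exact hC' _ hx.le _
    refine squeeze_zero_norm hb ?_
    simpa using (tendsto_self_mul_const_pow_of_lt_one (norm_nonneg x) hx).const_mul
      (C * E * (D * C))
  refine (tendsto_add_atTop_iff_nat 1).1 ?_
  simpa [← h1] using h2.sub h3

/-- The summand of the theta-type Lambert series of `ψ²`. -/
noncomputable def psiSqTerm (x : ℂ) (k : ℕ) : ℂ :=
  (-1) ^ k * x ^ (k ^ 2 + k) * (1 + x ^ (2 * k + 1)) / (1 - x ^ (2 * k + 1))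

/-- For base `x²` the quotient is essentially `(x; x²)_k / (x³; x²)_k`, which collapses to its end
factors. -/
lemma qNum_inv_div_qPoch (hx0 : x ≠ 0) (hx : ‖x‖ < 1) (k : ℕ) :
    qNum 1 x⁻¹ (x ^ 2) k / qPoch (x ^ 2 * x ^ 2 * x⁻¹) (x ^ 2) k =
      (x ^ k)⁻¹ * ((1 - x) / (1 - x ^ (2 * k + 1))) := by
  have hx1 : 1 - x ≠ 0 := by simpa using one_sub_pow_succ_ne_zero hx 0
  induction k with
  | zero => simp [hx1]
  | succ k ih =>
    rw [qNum_succ, qPoch_succ, mul_div_mul_comm, ih]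
    have n1 : 1 - x ^ (2 * k + 1) ≠ 0 := one_sub_pow_succ_ne_zero hx _
    have e1 : x⁻¹ - 1 * (x ^ 2) ^ k = x⁻¹ * (1 - x ^ (2 * k + 1)) := by
      field_simp; ring
    have e2 : 1 - x ^ 2 * x ^ 2 * x⁻¹ * (x ^ 2) ^ k = 1 - x ^ (2 * (k + 1) + 1) := by
      field_simp; ring
    rw [e1, e2, pow_succ x k, mul_inv]
    field_simp

/-- This is `₆φ₅` with `a = p = x²` and both free parameters equal to `x`, that is, reciprocals
`x⁻¹`. Then `a p x y` becomes `x²`, and the numerator on the right cancels `(x²; x²)_n`. -/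
lemma sum_psiSqTerm_div (hx0 : x ≠ 0) (hx : ‖x‖ < 1) (n : ℕ) :
    ∑ k ∈ Finset.range (n + 1), psiSqTerm x k * ((qPoch (x ^ 2) (x ^ 2) (n - k))⁻¹ *
        (qPoch (x ^ 2) (x ^ 2) (n + k + 1))⁻¹) = ((qPoch x (x ^ 2) (n + 1))⁻¹) ^ 2 := by
  have hB := norm_sq_lt_one hx
  have e0 : x ^ 2 * x ^ 2 * x⁻¹ = x * x ^ 2 := by field_simp
  have hc : ‖x * x ^ 2‖ < 1 := by
    rw [norm_mul]; exact mul_lt_one_of_nonneg_of_lt_one_left (norm_nonneg _) hx hB.le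
  have h := sixPhiFive (a := x ^ 2) (p := x ^ 2) (x := x⁻¹) (y := x⁻¹) (mul_pow_ne_one hB hB)
    (mul_pow_ne_one hB hB) (by rw [e0]; exact mul_pow_ne_one hB hc)
    (by rw [e0]; exact mul_pow_ne_one hB hc) n
  have n1 : 1 - x ≠ 0 := by simpa using one_sub_pow_succ_ne_zero hx 0
  have n2 : 1 - x ^ 2 ≠ 0 := one_sub_pow_succ_ne_zero hx 1
  have n3 : qPoch (x ^ 2) (x ^ 2) n ≠ 0 := qPoch_ne_zero_of_norm_lt hB hB n
  rw [e0, show x * x ^ 2 * x⁻¹ = x ^ 2 by field_simp, mul_assoc, ← div_div, div_self n3] at h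
  rw [qPoch_succ' x, mul_inv, mul_pow]
  have h2 : ((1 - x)⁻¹) ^ 2 * ((qPoch (x * x ^ 2) (x ^ 2) n)⁻¹) ^ 2 = ((1 - x)⁻¹) ^ 2 *
      (1 / (qPoch (x * x ^ 2) (x ^ 2) n * qPoch (x * x ^ 2) (x ^ 2) n)) := by
    rw [one_div, mul_inv]; ring
  rw [h2, ← h, Finset.mul_sum]
  refine Finset.sum_congr rfl fun k hk => ?_
  clear hk
  have e3 : ∏ j ∈ Finset.range k, (-x ^ 2 * (x ^ 2) ^ (j + 1)) =
      (-1) ^ k * (x ^ (k ^ 2 + k) * (x ^ k * x ^ k)) := by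
    induction k with
    | zero => simp
    | succ k ih => rw [Finset.prod_range_succ, ih]; ring
  have n4 : 1 - x ^ (2 * k + 1) ≠ 0 := one_sub_pow_succ_ne_zero hx _
  have n5 : qPoch (x ^ 2) (x ^ 2) k ≠ 0 := qPoch_ne_zero_of_norm_lt hB hB k
  rw [wellPoised, qNum_inv_div_qPoch hx0 hx, e3, psiSqTerm, qPoch_succ' (x ^ 2),
    show x ^ 2 * (x ^ 2) ^ (2 * k) = x ^ (2 * k + 1) * x ^ (2 * k + 1) by ring]
  have e4 : 1 - x ^ (2 * k + 1) * x ^ (2 * k + 1) =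
    (1 - x ^ (2 * k + 1)) * (1 + x ^ (2 * k + 1)) := by ring
  rw [e4]
  generalize 1 + x ^ (2 * k + 1) = v at *
  generalize 1 - x ^ (2 * k + 1) = u at *
  generalize 1 - x = t at *
  generalize x ^ (k ^ 2 + k) = Z at *
  have n6 : x ^ k ≠ 0 := pow_ne_zero _ hx0
  generalize x ^ k = K at *
  rw [div_eq_mul_inv _ (_ * _), div_eq_mul_inv _ (_ * _), mul_inv, mul_inv, mul_inv]
  field_simp

lemma exists_norm_psiSqTerm_le (hx : ‖x‖ < 1) :
    ∃ C : ℝ, ∀ k, ‖psiSqTerm x k‖ ≤ C * ‖x‖ ^ k := by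
  have h1 : 0 < 1 - ‖x‖ := by linarith
  refine ⟨2 * (1 - ‖x‖)⁻¹, fun k => ?_⟩
  rw [psiSqTerm, div_eq_mul_inv]
  simp only [norm_mul, norm_pow, norm_neg, norm_one, one_pow, one_mul]
  have h2 : ‖1 + x ^ (2 * k + 1)‖ ≤ 2 := by
    refine (norm_add_le _ _).trans ?_
    rw [norm_one, norm_pow]
    linarith [pow_le_one₀ (norm_nonneg x) hx.le (n := 2 * k + 1)]
  have h3 : ‖x‖ ^ (k ^ 2 + k) ≤ ‖x‖ ^ k :=
    pow_le_pow_of_le_one (norm_nonneg _) hx.le (Nat.le_add_left _ _)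
  calc _ ≤ ‖x‖ ^ k * 2 * (1 - ‖x‖)⁻¹ := by
        gcongr ?_ * ?_ * ?_
        · exact norm_inv_one_sub_le (norm_pow_succ_le hx _) hx
    _ = _ := by ring

/-- Let `n → ∞` in `sum_psiSqTerm_div` by dominated convergence. With `l = (x²; x²)_∞`, the left
side tends to `l⁻²` times the series, and the right side to `(ψ(x) / l)²` by Gauss's product. -/
theorem hasSum_psiSqTerm (hx0 : x ≠ 0) (hx : ‖x‖ < 1) :
    HasSum (psiSqTerm x) (ramanujanPsi x ^ 2) := by
  have hB := norm_sq_lt_one hx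
  obtain ⟨l, hl, hlim⟩ := exists_tendsto_qPoch hB hB
  obtain ⟨D, hD, hD'⟩ := exists_norm_qPoch_inv_le hB (norm_nonneg _) hB
  obtain ⟨C, hC⟩ := exists_norm_psiSqTerm_le hx
  have hg := summable_geometric_of_lt_one (norm_nonneg x) hx
  have hs : Summable (psiSqTerm x) := .of_norm_bounded (hg.mul_left C) hC
  let f : ℕ → ℕ → ℂ := fun n k => if k ≤ n then psiSqTerm x k *
    ((qPoch (x ^ 2) (x ^ 2) (n - k))⁻¹ * (qPoch (x ^ 2) (x ^ 2) (n + k + 1))⁻¹) else 0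
  have hf : ∀ n, ∑' k, f n k = ((qPoch x (x ^ 2) (n + 1))⁻¹) ^ 2 := fun n => by
    rw [← sum_psiSqTerm_div hx0 hx, tsum_eq_sum (s := Finset.range (n + 1))]
    · refine Finset.sum_congr rfl fun k hk => ?_
      exact if_pos (Nat.lt_succ_iff.1 (Finset.mem_range.1 hk))
    · intro k hk
      rw [Finset.mem_range, Nat.lt_succ_iff] at hk
      exact if_neg hk
  have h1 : Tendsto (fun n => ∑' k, f n k) atTop (𝓝 (∑' k, psiSqTerm x k * (l⁻¹ * l⁻¹))) := by
    refine tendsto_tsum_of_dominated_convergence (hg.mul_left (C * (D * D))) (fun k => ?_)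
      (.of_forall fun n k => ?_)
    · have a1 : Tendsto (fun n => (qPoch (x ^ 2) (x ^ 2) (n - k))⁻¹) atTop (𝓝 l⁻¹) :=
        (hlim.comp (tendsto_sub_atTop_nat k)).inv₀ hl
      have a2 : Tendsto (fun n => (qPoch (x ^ 2) (x ^ 2) (n + k + 1))⁻¹) atTop (𝓝 l⁻¹) :=
        (hlim.comp (tendsto_add_atTop_nat (k + 1))).inv₀ hl
      refine ((a1.mul a2).const_mul (psiSqTerm x k)).congr' ?_
      filter_upwards [eventually_ge_atTop k] with n hn
      exact (if_pos hn).symm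
    · simp only [f]
      split_ifs with h
      · rw [norm_mul, norm_mul]
        calc _ ≤ C * ‖x‖ ^ k * (D * D) := by
              gcongr
              · exact (norm_nonneg _).trans (hC k)
              · exact hC k
              · exact hD' _ le_rfl _
              · exact hD' _ le_rfl _
          _ = _ := by ring
      · rw [norm_zero]
        have := (norm_nonneg _).trans (hC k)
        have : 0 ≤ C * ‖x‖ ^ k * (D * D) := by positivity
        linarith
  have h2 : Tendsto (fun n => ∑' k, f n k) atTop (𝓝 ((ramanujanPsi x * l⁻¹) ^ 2)) := by
    have := (((tendsto_psiProd hx).mul (hlim.inv₀ hl)).pow 2).comp (tendsto_add_atTop_nat 1)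
    refine this.congr fun n => ?_
    have n3 : qPoch (x ^ 2) (x ^ 2) (n + 1) ≠ 0 := qPoch_ne_zero_of_norm_lt hB hB _
    rw [hf, Function.comp_apply, psiProd]
    congr 1
    field_simp
  have h3 := tendsto_nhds_unique h1 h2
  rw [tsum_mul_right] at h3
  have h4 : ∑' k, psiSqTerm x k = ramanujanPsi x ^ 2 := by
    field_simp at h3
    exact h3
  rw [← h4]
  exact hs.hasSum

end theta

/-! ### From the theta-type series to `∑ w^j / (1 + w^{2j+1})` -/

section rearrangement

variable {w : ℂ}

/-- The partially resummed double series interpolating between two forms of a Lambert series. -/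
noncomputable def durfeeTerm (w : ℂ) (n j : ℕ) : ℂ :=
  (-1) ^ n * w ^ (2 * (n ^ 2 + n)) * (w ^ (j * (2 * n + 1)) / (1 + w ^ (2 * j + 2 * n + 1)))

lemma norm_durfeeTerm_le (hw : ‖w‖ < 1) (n j : ℕ) :
    ‖durfeeTerm w n j‖ ≤ ‖w‖ ^ n * (1 - ‖w‖)⁻¹ * ‖w‖ ^ j := by
  rw [durfeeTerm, div_eq_mul_inv]
  simp only [norm_mul, norm_pow, norm_neg, norm_one, one_pow, one_mul]
  have h1 : ‖(1 + w ^ (2 * j + 2 * n + 1))⁻¹‖ ≤ (1 - ‖w‖)⁻¹ := by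
    rw [← sub_neg_eq_add]
    exact norm_inv_one_sub_le (by rw [norm_neg]; exact norm_pow_succ_le hw _) hw
  have h2 : ‖w‖ ^ (2 * (n ^ 2 + n)) ≤ ‖w‖ ^ n :=
    pow_le_pow_of_le_one (norm_nonneg _) hw.le (by nlinarith)
  have h3 : ‖w‖ ^ (j * (2 * n + 1)) ≤ ‖w‖ ^ j :=
    pow_le_pow_of_le_one (norm_nonneg _) hw.le (by nlinarith)
  calc _ ≤ ‖w‖ ^ n * (‖w‖ ^ j * (1 - ‖w‖)⁻¹) := by gcongr ?_ * (?_ * ?_)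
    _ = _ := by ring

lemma summable_durfeeTerm (hw : ‖w‖ < 1) (n : ℕ) : Summable (durfeeTerm w n) :=
  .of_norm_bounded ((summable_geometric_of_lt_one (norm_nonneg w) hw).mul_left _)
    (norm_durfeeTerm_le hw n)

lemma one_add_pow_succ_ne_zero (hw : ‖w‖ < 1) (n : ℕ) : 1 + w ^ (n + 1) ≠ 0 := by
  intro h
  have h1 : w ^ (n + 1) = -1 := by linear_combination h
  have h2 := norm_pow_succ_le hw n
  rw [h1, norm_neg, norm_one] at h2
  linarith

/-- Expanding the denominator, `∑_j durfeeTerm w n j` is the sum of `(-1)^M w^{2JM+J+M}` over `J, M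
≥ n`. The difference is the hook `min(J, M) = n`, whose value with `u = w^{2n+1}` is `(-1)^n
w^{2(n²+n)} (1/(1+u) + u/(1-u))`. -/
lemma tsum_durfeeTerm_sub (hw : ‖w‖ < 1) (n : ℕ) :
    ∑' j, durfeeTerm w n j - ∑' j, durfeeTerm w (n + 1) j = psiSqTerm (w ^ 2) n := by
  have hs := summable_durfeeTerm hw n
  rw [hs.tsum_eq_zero_add, add_sub_assoc,
    ← ((summable_nat_add_iff 1).2 hs).tsum_sub (summable_durfeeTerm hw (n + 1))]
  have hu : ‖w ^ (2 * n + 1)‖ < 1 := (norm_pow_succ_le hw _).trans_lt hw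
  -- Of the row `J = n + j + 1` only the entry `M = n` survives, which leaves a geometric series in
  -- `j`.
  have e : ∀ j, durfeeTerm w n (j + 1) - durfeeTerm w (n + 1) j =
      (-1) ^ n * w ^ (2 * (n ^ 2 + n)) * w ^ (2 * n + 1) * (w ^ (2 * n + 1)) ^ j := fun j => by
    have n1 : 1 + w ^ (2 * j + 2 * n + 2 + 1) ≠ 0 := one_add_pow_succ_ne_zero hw _
    rw [durfeeTerm, durfeeTerm, show 2 * (j + 1) + 2 * n + 1 = 2 * j + 2 * n + 2 + 1 by ring,
      show 2 * j + 2 * (n + 1) + 1 = 2 * j + 2 * n + 2 + 1 by ring, pow_succ (-1 : ℂ)]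
    have e1 : w ^ (2 * ((n + 1) ^ 2 + (n + 1))) * w ^ (j * (2 * (n + 1) + 1)) =
        w ^ (2 * (n ^ 2 + n)) * w ^ ((j + 1) * (2 * n + 1)) * w ^ (2 * j + 2 * n + 2 + 1) := by
      simp only [← pow_add]; congr 1; ring
    have e2 : w ^ (2 * n + 1) * (w ^ (2 * n + 1)) ^ j = w ^ ((j + 1) * (2 * n + 1)) := by
      rw [← pow_succ', ← pow_mul, mul_comm]
    rw [mul_assoc _ (w ^ (2 * n + 1)), e2, ← mul_div_assoc, ← mul_div_assoc, ← sub_div,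
      div_eq_iff n1]
    linear_combination (-1) ^ n * e1
  simp only [e]
  rw [tsum_mul_left, tsum_geometric_of_norm_lt_one hu, durfeeTerm, psiSqTerm]
  have n1 : 1 + w ^ (2 * n + 1) ≠ 0 := one_add_pow_succ_ne_zero hw _
  have n2 : 1 - w ^ (2 * n + 1) ≠ 0 := one_sub_pow_succ_ne_zero hw _
  have e3 : (w ^ 2) ^ (2 * n + 1) = w ^ (2 * n + 1) * w ^ (2 * n + 1) := by ring
  have e4 : 1 - w ^ (2 * n + 1) * w ^ (2 * n + 1) =
    (1 + w ^ (2 * n + 1)) * (1 - w ^ (2 * n + 1)) := by ring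
  rw [e3, e4, zero_mul, pow_zero, mul_zero, zero_add, ← pow_mul]
  generalize w ^ (2 * n + 1) = u at *
  field_simp
  ring

/-- The whole quadrant `n = 0` is the desired series. Removing hooks one by one gives the series of
`psiSqTerm (w ^ 2)`, and the remaining quadrants tend to zero. -/
theorem hasSum_psi_sq (hw0 : w ≠ 0) (hw : ‖w‖ < 1) :
    HasSum (fun j : ℕ => w ^ j / (1 + w ^ (2 * j + 1))) (ramanujanPsi (w ^ 2) ^ 2) := by
  have h0 : durfeeTerm w 0 = fun j : ℕ => w ^ j / (1 + w ^ (2 * j + 1)) := by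
    ext j; simp [durfeeTerm]
  have hp : ∀ N, ∑ n ∈ Finset.range N, psiSqTerm (w ^ 2) n =
      ∑' j, durfeeTerm w 0 j - ∑' j, durfeeTerm w N j := fun N => by
    simp only [← tsum_durfeeTerm_sub hw]
    rw [Finset.sum_range_sub']
  have hlim : Tendsto (fun N => ∑' j, durfeeTerm w N j) atTop (𝓝 0) := by
    have hb : ∀ N, ‖∑' j, durfeeTerm w N j‖ ≤ ‖w‖ ^ N * ((1 - ‖w‖)⁻¹ * (1 - ‖w‖)⁻¹) := fun N =>
      (tsum_of_norm_bounded ((hasSum_geometric_of_lt_one (norm_nonneg w) hw).mul_left _)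
        (norm_durfeeTerm_le hw N)).trans_eq (by ring)
    refine squeeze_zero_norm hb ?_
    simpa using (tendsto_pow_atTop_nhds_zero_of_lt_one (norm_nonneg w) hw).mul_const
      ((1 - ‖w‖)⁻¹ * (1 - ‖w‖)⁻¹)
  have h1 := (hasSum_psiSqTerm (pow_ne_zero 2 hw0) (norm_sq_lt_one hw)).tendsto_sum_nat
  simp only [hp] at h1
  have h2 := tendsto_nhds_unique h1 (hlim.const_sub _)
  rw [h2, sub_zero, ← h0]
  exact (summable_durfeeTerm hw 0).hasSum

end rearrangement

/-! ### Specialization to `a = ∓i/q` and base `q²` -/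

section specialization

variable {a q x : ℂ}

lemma HasSum.pnat {f : ℕ+ → ℂ} {g : ℕ → ℂ} {A : ℂ} (h : HasSum g A)
    (hfg : ∀ n : ℕ, f n.succPNat = g n) : HasSum f A := by
  rw [← Equiv.pnatEquivNat.symm.hasSum_iff]
  exact (funext hfg : f ∘ Equiv.pnatEquivNat.symm = g) ▸ h

lemma qNum_inv {ρ : ℂ} (hρ : ρ ≠ 0) (b p : ℂ) (n : ℕ) :
    qNum b ρ⁻¹ p n = qPoch (b * ρ) p n / ρ ^ n := by
  rw [qNum, qPoch, ← Finset.card_range n, ← Finset.prod_const, Finset.card_range,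
    ← Finset.prod_div_distrib]
  refine Finset.prod_congr rfl fun j _ => ?_
  field_simp

lemma qNum_zero_right (b q : ℂ) (n : ℕ) :
    qNum b 0 (q ^ 2) n = (-b) ^ n * q ^ (n ^ 2 - n) := by
  induction n with
  | zero => simp
  | succ n ih =>
    have h1 : n ^ 2 - n = n * (n - 1) := by rw [Nat.mul_sub_one, sq]
    have h2 : (n + 1) ^ 2 - (n + 1) = n * (n - 1) + 2 * n := by
      cases n with
      | zero => simp
      | succ n => rw [Nat.sub_eq_iff_eq_add (by nlinarith)]; simp; ring
    rw [qNum_succ, ih, h1, h2, pow_add, ← pow_mul]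
    ring

lemma qPoch_zero_left (p : ℂ) (n : ℕ) : qPoch 0 p n = 1 := by simp [qPoch]

lemma veryWellPoisedTerm_eq (haz : a ^ 2 * q ^ 2 = -1) (x : ℂ) (k : ℕ) :
    veryWellPoisedTerm a (q ^ 2) x k = (1 - a * q ^ (4 * (k + 1))) * qPoch a (q ^ 2) (k + 1) *
      (qNum 1 x (q ^ 2) (k + 1) / qPoch (a * q ^ 2 * x) (q ^ 2) (k + 1)) *
      qPoch (q ^ 2) (q ^ 2) (2 * (k + 1) - 1) * (-1) ^ (k + 1) /
      ((1 - a) * qPoch (q ^ 2) (q ^ 2) (k + 1) * qPoch (-1) (q ^ 2) (2 * (k + 1))) := by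
  rw [veryWellPoisedTerm, veryWellPoised, haz, ← pow_mul,
    show 2 * (2 * (k + 1)) = 4 * (k + 1) by ring, show 2 * (k + 1) - 1 = 2 * k + 1 by omega,
    show 2 * (k + 1) = 2 * k + 1 + 1 by ring]
  simp only [div_eq_mul_inv, mul_inv]
  ring

lemma veryWellPoisedTerm_inv {ρ : ℂ} (hρ : ρ ≠ 0) (haz : a ^ 2 * q ^ 2 = -1) (k : ℕ) :
    veryWellPoisedTerm a (q ^ 2) ρ⁻¹ k =
      ((1 - a * q ^ (4 * (k + 1))) * (qPoch a (q ^ 2) (k + 1) * qPoch ρ (q ^ 2) (k + 1)) *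
        qPoch (q ^ 2) (q ^ 2) (2 * (k + 1) - 1) * (-1) ^ (k + 1)) /
      ((1 - a) * (qPoch (a * q ^ 2 / ρ) (q ^ 2) (k + 1) * qPoch (q ^ 2) (q ^ 2) (k + 1)) *
        qPoch (-1) (q ^ 2) (2 * (k + 1)) * ρ ^ (k + 1)) := by
  rw [veryWellPoisedTerm_eq haz, qNum_inv hρ, one_mul]
  simp only [div_eq_mul_inv, mul_inv]
  ring

lemma veryWellPoisedTerm_inv_self (ha : a ≠ 0) (haz : a ^ 2 * q ^ 2 = -1) (k : ℕ) :
    veryWellPoisedTerm a (q ^ 2) a⁻¹ k =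
      ((1 - a * q ^ (4 * (k + 1))) * (qPoch a (q ^ 2) (k + 1) * qPoch a (q ^ 2) (k + 1)) *
        qPoch (q ^ 2) (q ^ 2) (2 * (k + 1) - 1) * (-a⁻¹) ^ (k + 1)) /
      ((1 - a) * (qPoch (q ^ 2) (q ^ 2) (k + 1) * qPoch (q ^ 2) (q ^ 2) (k + 1)) *
        qPoch (-1) (q ^ 2) (2 * (k + 1))) := by
  rw [veryWellPoisedTerm_inv ha haz, neg_pow a⁻¹, mul_div_cancel_left₀ _ ha]
  simp only [div_eq_mul_inv, mul_inv, inv_pow]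
  ring

lemma veryWellPoisedTerm_zero (haz : a ^ 2 * q ^ 2 = -1) (k : ℕ) :
    veryWellPoisedTerm a (q ^ 2) 0 k =
      ((1 - a * q ^ (4 * (k + 1))) * qPoch a (q ^ 2) (k + 1) *
        qPoch (q ^ 2) (q ^ 2) (2 * (k + 1) - 1) * q ^ ((k + 1) ^ 2 - (k + 1))) /
      ((1 - a) * qPoch (q ^ 2) (q ^ 2) (k + 1) * qPoch (-1) (q ^ 2) (2 * (k + 1))) := by
  rw [veryWellPoisedTerm_eq haz, qNum_zero_right, mul_zero, qPoch_zero_left, div_one]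
  congr 1
  have : ((-1 : ℂ)) ^ (k + 1) * (-1) ^ (k + 1) = 1 := by
    rw [← mul_pow]; norm_num
  linear_combination (1 - a * q ^ (4 * (k + 1))) * qPoch a (q ^ 2) (k + 1) *
    qPoch (q ^ 2) (q ^ 2) (2 * (k + 1) - 1) * q ^ ((k + 1) ^ 2 - (k + 1)) * this

lemma wellPoisedTerm_inv {ρ : ℂ} (hρ : ρ ≠ 0) (haz : a ^ 2 * q ^ 2 = -1) (k : ℕ) :
    wellPoisedTerm a (q ^ 2) ρ⁻¹ k =
      (qPoch (a⁻¹ * ρ) (q ^ 2) (k + 1) * (-1) ^ (k + 1)) /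
      (qPoch (a * q ^ 2 / ρ) (q ^ 2) (k + 1) * (1 - q ^ (2 * (k + 1))) * ρ ^ (k + 1)) := by
  rw [wellPoisedTerm, qNum_inv hρ, haz, ← pow_mul]
  simp only [div_eq_mul_inv, mul_inv]
  ring

/-- The factor `j = 0` of the numerator is `x - a⁻¹`. With this choice the Lambert series is minus
the very-well-poised series. -/
lemma wellPoisedTerm_inv_self (p : ℂ) (k : ℕ) : wellPoisedTerm a p a⁻¹ k = 0 := by
  have : qNum a⁻¹ a⁻¹ p (k + 1) = 0 :=
    Finset.prod_eq_zero (Finset.mem_range.2 k.succ_pos) (by simp)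
  simp [wellPoisedTerm, this]

lemma wellPoisedTerm_zero (haz : a ^ 2 * q ^ 2 = -1) (k : ℕ) :
    wellPoisedTerm a (q ^ 2) 0 k =
      a⁻¹ ^ (k + 1) * q ^ ((k + 1) ^ 2 - (k + 1)) / (1 - q ^ (2 * (k + 1))) := by
  rw [wellPoisedTerm, qNum_zero_right, mul_zero, qPoch_zero_left, haz, ← pow_mul, neg_pow a⁻¹]
  have : ((-1 : ℂ)) ^ (k + 1) * (-1) ^ (k + 1) = 1 := by
    rw [← mul_pow]; norm_num
  linear_combination a⁻¹ ^ (k + 1) * q ^ ((k + 1) ^ 2 - (k + 1)) / (1 - q ^ (2 * (k + 1))) * this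

lemma summable_lambertTerm {p : ℂ} (hp0 : p ≠ 0) (hp : ‖p‖ < 1) (haz : a ^ 2 * p = -1) :
    Summable (lambertTerm a p) := by
  have hnz : ‖a‖ ^ 2 * ‖p‖ = 1 := by
    rw [← norm_pow, ← norm_mul, haz, norm_neg, norm_one]
  have ha : 1 < ‖a‖ := by
    by_contra! h
    have h1 : ‖a‖ ^ 2 ≤ 1 := pow_le_one₀ (norm_nonneg _) h
    nlinarith [norm_nonneg p]
  have hap : ‖a * p‖ < 1 := norm_mul_lt_one ha (by simp [haz]) hp0
  obtain ⟨C, hC⟩ := exists_norm_lambertTerm_le hp hap ‖1 - a‖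
  exact .of_norm_bounded ((summable_geometric_of_lt_one (norm_nonneg p) hp).mul_left C)
    -- The point `a` itself is dominated, with `r = 1` and `δ = ‖1 - a‖`.
    (hC a ⟨ha.le, le_rfl, le_rfl, 1, zero_le_one, le_rfl, by simpa using haz⟩)

open Complex

/-- The parts in `a² p = -1` cancel. With `t = i q^{2i+1}` (the exponent's `i` being the index), the
rest is `t/(1+t) + t/(1-t) = 2t/(1-t²)`, and `1 - t² = 1 + q^{4i+2}`; then `hasSum_psi_sq` applies
with `w = q²`. -/
lemma tsum_lambertTerm_sub (hq0 : q ≠ 0) (hq : ‖q‖ < 1) :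
    ∑' i, lambertTerm (-I / q) (q ^ 2) i - ∑' i, lambertTerm (I / q) (q ^ 2) i =
      2 * I * q * ramanujanPsi (q ^ 4) ^ 2 := by
  have hp0 : q ^ 2 ≠ 0 := pow_ne_zero 2 hq0
  have hp : ‖q ^ 2‖ < 1 := norm_sq_lt_one hq
  have h1 : (-I / q) ^ 2 * q ^ 2 = -1 := by field_simp; simp
  have h2 : (I / q) ^ 2 * q ^ 2 = -1 := by field_simp; simp
  have h3 := (hasSum_psi_sq hp0 hp).mul_left (2 * I * q)
  rw [← pow_mul, show 2 * 2 = 4 by rfl] at h3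
  rw [← (summable_lambertTerm hp0 hp h1).tsum_sub (summable_lambertTerm hp0 hp h2), ← h3.tsum_eq]
  refine tsum_congr fun i => ?_
  rw [lambertTerm, lambertTerm, h1, h2]
  have e1 : -I / q * q ^ 2 * (q ^ 2) ^ i = -(I * q * (q ^ 2) ^ i) := by field_simp
  have e2 : I / q * q ^ 2 * (q ^ 2) ^ i = I * q * (q ^ 2) ^ i := by field_simp
  have e3 : 1 + (q ^ 2) ^ (2 * i + 1) =
      (1 + I * q * (q ^ 2) ^ i) * (1 - I * q * (q ^ 2) ^ i) := by
    linear_combination (q ^ 2 * ((q ^ 2) ^ i) ^ 2) * I_sq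
  have n1 : 1 + (q ^ 2) ^ (2 * i + 1) ≠ 0 := one_add_pow_succ_ne_zero hp _
  rw [e3] at n1
  have n2 := left_ne_zero_of_mul n1
  have n3 := right_ne_zero_of_mul n1
  rw [e1, e2, e3, sub_neg_eq_add]
  rw [← mul_div_assoc, mul_assoc 2 I q, mul_assoc 2]
  generalize I * q * (q ^ 2) ^ i = t at *
  generalize e4 : 1 + t = u at *
  generalize e5 : 1 - t = v at *
  field_simp
  rw [← e4, ← e5]
  ring

/-- At `x = 0` the two summands differ only in `(iq)^{k+1}` against `(-iq)^{k+1}`, so odd `k`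
cancels and `k = 2n` doubles. -/
lemma hasSum_odd_part (hq0 : q ≠ 0) {W₁ W₂ : ℂ}
    (h1 : HasSum (wellPoisedTerm (-I / q) (q ^ 2) 0) W₁)
    (h2 : HasSum (wellPoisedTerm (I / q) (q ^ 2) 0) W₂) :
    HasSum (fun n : ℕ => ((-1) ^ n * q ^ (4 * n ^ 2 + 4 * n)) / (1 - q ^ (4 * n + 2)))
      ((2 * I * q)⁻¹ * (W₁ - W₂)) := by
  have e1 : (-I / q) ^ 2 * q ^ 2 = -1 := by field_simp; simp
  have e2 : (I / q) ^ 2 * q ^ 2 = -1 := by field_simp; simp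
  have i1 : (-I / q)⁻¹ = I * q := by rw [inv_div, neg_eq_neg_one_mul, div_mul_eq_div_div]; simp; ring
  have i2 : (I / q)⁻¹ = -(I * q) := by rw [inv_div, div_eq_mul_inv, inv_I]; ring
  have h := (h1.sub h2).mul_left (2 * I * q)⁻¹
  have hinj : Function.Injective fun n : ℕ => 2 * n := fun m n h => by simpa using h
  rw [← hinj.hasSum_iff] at h
  · convert h using 1
    · rfl
    ext n
    rw [Function.comp_apply, wellPoisedTerm_zero e1, wellPoisedTerm_zero e2, i1, i2,
      Odd.neg_pow ⟨n, rfl⟩, mul_pow, pow_succ I, pow_mul I, I_sq,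
      show (2 * n + 1) ^ 2 - (2 * n + 1) = 4 * n ^ 2 + 2 * n by
        rw [Nat.sub_eq_iff_eq_add (by nlinarith)]; ring,
      show 2 * (2 * n + 1) = 4 * n + 2 by ring,
      show 4 * n ^ 2 + 4 * n = (4 * n ^ 2 + 2 * n) + 2 * n by ring, pow_add q _ (2 * n),
      pow_succ q (2 * n)]
    have : (2 * I * q)⁻¹ * (2 * I * q) = 1 := inv_mul_cancel₀ (by simp [hq0])
    linear_combination -(((-1) ^ n * (q ^ (4 * n ^ 2 + 2 * n) * q ^ (2 * n))) /
      (1 - q ^ (4 * n + 2))) * this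
  · intro k hk
    have hodd : Odd k := by
      by_contra hk'
      rw [Nat.not_odd_iff_even] at hk'
      obtain ⟨m, rfl⟩ := hk'
      exact hk ⟨m, by simp; ring⟩
    rw [wellPoisedTerm_zero e1, wellPoisedTerm_zero e2, i1, i2, Even.neg_pow hodd.add_one, sub_self,
      mul_zero]

end specialization

/-! ### The three formulas for `ψ(q⁴)²` -/

open Complex in
theorem corollary5 (q ρ₁ : ℂ) (hq0 : 0 < ‖q‖) (hq1 : ‖q‖ < 1) (hρ₁ : 1 < ‖ρ₁‖) :
    (∃ A₁ A₂ : ℂ,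
      HasSum (fun n : ℕ+ =>
        ((1 + I * q ^ (4 * (n : ℕ) - 1)) * (qPoch (-I / q) (q ^ 2) n * qPoch (-I / q) (q ^ 2) n) *
            qPoch (q ^ 2) (q ^ 2) (2 * (n : ℕ) - 1) * (-I * q) ^ (n : ℕ)) /
          ((1 + I / q) * (qPoch (q ^ 2) (q ^ 2) n * qPoch (q ^ 2) (q ^ 2) n) *
            qPoch (-1) (q ^ 2) (2 * (n : ℕ)))) A₁ ∧
      HasSum (fun n : ℕ+ =>
        ((1 - I * q ^ (4 * (n : ℕ) - 1)) * (qPoch (I / q) (q ^ 2) n * qPoch (I / q) (q ^ 2) n) *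
            qPoch (q ^ 2) (q ^ 2) (2 * (n : ℕ) - 1) * (I * q) ^ (n : ℕ)) /
          ((1 - I / q) * (qPoch (q ^ 2) (q ^ 2) n * qPoch (q ^ 2) (q ^ 2) n) *
            qPoch (-1) (q ^ 2) (2 * (n : ℕ)))) A₂ ∧
      ramanujanPsi (q ^ 4) ^ 2 = I / (2 * q) * (A₁ - A₂)) ∧
    (∃ B₁ B₂ B₃ B₄ : ℂ,
      HasSum (fun n : ℕ+ =>
        (qPoch (I * ρ₁ * q) (q ^ 2) n * (-1) ^ (n : ℕ)) /
          (qPoch (-I * q / ρ₁) (q ^ 2) n * (1 - q ^ (2 * (n : ℕ))) * ρ₁ ^ (n : ℕ))) B₁ ∧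
      HasSum (fun n : ℕ+ =>
        (qPoch (-I * ρ₁ * q) (q ^ 2) n * (-1) ^ (n : ℕ)) /
          (qPoch (I * q / ρ₁) (q ^ 2) n * (1 - q ^ (2 * (n : ℕ))) * ρ₁ ^ (n : ℕ))) B₂ ∧
      HasSum (fun n : ℕ+ =>
        ((1 - I * q ^ (4 * (n : ℕ) - 1)) * (qPoch (I / q) (q ^ 2) n * qPoch ρ₁ (q ^ 2) n) *
            qPoch (q ^ 2) (q ^ 2) (2 * (n : ℕ) - 1) * (-1) ^ (n : ℕ)) /
          ((1 - I / q) * (qPoch (I * q / ρ₁) (q ^ 2) n * qPoch (q ^ 2) (q ^ 2) n) *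
            qPoch (-1) (q ^ 2) (2 * (n : ℕ)) * ρ₁ ^ (n : ℕ))) B₃ ∧
      HasSum (fun n : ℕ+ =>
        ((1 + I * q ^ (4 * (n : ℕ) - 1)) * (qPoch (-I / q) (q ^ 2) n * qPoch ρ₁ (q ^ 2) n) *
            qPoch (q ^ 2) (q ^ 2) (2 * (n : ℕ) - 1) * (-1) ^ (n : ℕ)) /
          ((1 + I / q) * (qPoch (-I * q / ρ₁) (q ^ 2) n * qPoch (q ^ 2) (q ^ 2) n) *
            qPoch (-1) (q ^ 2) (2 * (n : ℕ)) * ρ₁ ^ (n : ℕ))) B₄ ∧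
      ramanujanPsi (q ^ 4) ^ 2 = 1 / (2 * I * q) * (B₁ - B₂ + B₃ - B₄)) ∧
    (∃ C₀ C₁ C₂ : ℂ,
      HasSum (fun n : ℕ =>
        ((-1) ^ n * q ^ (4 * n ^ 2 + 4 * n)) / (1 - q ^ (4 * n + 2))) C₀ ∧
      HasSum (fun n : ℕ+ =>
        ((1 - I * q ^ (4 * (n : ℕ) - 1)) * qPoch (I / q) (q ^ 2) n *
            qPoch (q ^ 2) (q ^ 2) (2 * (n : ℕ) - 1) * q ^ ((n : ℕ) ^ 2 - (n : ℕ))) /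
          ((1 - I / q) * qPoch (q ^ 2) (q ^ 2) n * qPoch (-1) (q ^ 2) (2 * (n : ℕ)))) C₁ ∧
      HasSum (fun n : ℕ+ =>
        ((1 + I * q ^ (4 * (n : ℕ) - 1)) * qPoch (-I / q) (q ^ 2) n *
            qPoch (q ^ 2) (q ^ 2) (2 * (n : ℕ) - 1) * q ^ ((n : ℕ) ^ 2 - (n : ℕ))) /
          ((1 + I / q) * qPoch (q ^ 2) (q ^ 2) n * qPoch (-1) (q ^ 2) (2 * (n : ℕ)))) C₂ ∧
      ramanujanPsi (q ^ 4) ^ 2 = C₀ + 1 / (2 * I * q) * (C₁ - C₂)) := by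
  have hq : q ≠ 0 := norm_pos_iff.1 hq0
  have hρ : ρ₁ ≠ 0 := norm_pos_iff.1 (by linarith)
  have hp0 : q ^ 2 ≠ 0 := pow_ne_zero 2 hq
  have hp : ‖q ^ 2‖ < 1 := norm_sq_lt_one hq1
  have z₁ : (-I / q) ^ 2 * q ^ 2 = -1 := by field_simp; simp
  have z₂ : (I / q) ^ 2 * q ^ 2 = -1 := by field_simp; simp
  have a₁ : -I / q ≠ 0 := div_ne_zero (neg_ne_zero.2 I_ne_zero) hq
  have a₂ : I / q ≠ 0 := div_ne_zero I_ne_zero hq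
  have i₁ : (-I / q)⁻¹ = I * q := by rw [inv_div, div_eq_mul_inv, inv_neg, inv_I]; ring
  have i₂ : (I / q)⁻¹ = -I * q := by rw [inv_div, div_eq_mul_inv, inv_I]; ring
  have c₁ : -I / q * q ^ 2 = -I * q := by field_simp
  have c₂ : I / q * q ^ 2 = I * q := by field_simp
  have d₁ : ∀ n : ℕ, 1 - -I / q * q ^ (4 * (n + 1)) = 1 + I * q ^ (4 * (n + 1) - 1) := fun n => by
    rw [show 4 * (n + 1) = 4 * (n + 1) - 1 + 1 by omega, pow_succ]
    field_simp
    simp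
  have d₂ : ∀ n : ℕ, 1 - I / q * q ^ (4 * (n + 1)) = 1 - I * q ^ (4 * (n + 1) - 1) := fun n => by
    rw [show 4 * (n + 1) = 4 * (n + 1) - 1 + 1 by omega, pow_succ]
    field_simp
    simp
  have f₁ : 1 - -I / q = 1 + I / q := by ring
  have hL := tsum_lambertTerm_sub hq hq1
  have hIq : 2 * I * q ≠ 0 := mul_ne_zero (mul_ne_zero two_ne_zero I_ne_zero) hq
  refine ⟨?_, ?_, ?_⟩
  · have x₁ : ‖(-I / q)⁻¹‖ < 1 := by rw [i₁]; simpa using hq1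
    have x₂ : ‖(I / q)⁻¹‖ < 1 := by rw [i₂]; simpa using hq1
    obtain ⟨τ₁, v₁, w₁⟩ := hasSum_transformation_of_eq_neg_one hp0 hp z₁ x₁
    obtain ⟨τ₂, v₂, w₂⟩ := hasSum_transformation_of_eq_neg_one hp0 hp z₂ x₂
    simp only [funext (wellPoisedTerm_inv_self (a := -I / q) (q ^ 2))] at w₁
    simp only [funext (wellPoisedTerm_inv_self (a := I / q) (q ^ 2))] at w₂
    -- The well-poised series vanishes identically, so each Lambert sum is `-τ`; hence `2iq ψ(q⁴)² =
    -- τ₂ - τ₁`.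
    have s₁ := w₁.unique hasSum_zero
    have s₂ := w₂.unique hasSum_zero
    refine ⟨τ₁, τ₂, ?_, ?_, ?_⟩
    · refine v₁.pnat fun n => ?_
      rw [Nat.succPNat_coe, Nat.succ_eq_add_one, veryWellPoisedTerm_inv_self a₁ z₁, d₁, f₁, i₁, neg_mul]
    · refine v₂.pnat fun n => ?_
      rw [Nat.succPNat_coe, Nat.succ_eq_add_one, veryWellPoisedTerm_inv_self a₂ z₂, d₂, i₂, neg_mul, neg_neg]
    · rw [div_mul_eq_mul_div, eq_div_iff (mul_ne_zero two_ne_zero hq)]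
      have : I * (2 * I * q * ramanujanPsi (q ^ 4) ^ 2) = I * (τ₂ - τ₁) := by
        rw [← hL]; linear_combination I * (s₁ - s₂)
      linear_combination -this + 2 * q * ramanujanPsi (q ^ 4) ^ 2 * I_sq
  · have x₁ : ‖ρ₁⁻¹‖ < 1 := by rw [norm_inv]; exact inv_lt_one_of_one_lt₀ hρ₁
    obtain ⟨τ₁, v₁, w₁⟩ := hasSum_transformation_of_eq_neg_one hp0 hp z₁ x₁
    obtain ⟨τ₂, v₂, w₂⟩ := hasSum_transformation_of_eq_neg_one hp0 hp z₂ x₁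
    refine ⟨∑' i, lambertTerm (-I / q) (q ^ 2) i + τ₁, ∑' i, lambertTerm (I / q) (q ^ 2) i + τ₂,
      τ₂, τ₁, ?_, ?_, ?_, ?_, ?_⟩
    · refine w₁.pnat fun n => ?_
      rw [Nat.succPNat_coe, Nat.succ_eq_add_one, wellPoisedTerm_inv hρ z₁, c₁, i₁, mul_right_comm]
    · refine w₂.pnat fun n => ?_
      rw [Nat.succPNat_coe, Nat.succ_eq_add_one, wellPoisedTerm_inv hρ z₂, c₂, i₂, mul_right_comm]
    · refine v₂.pnat fun n => ?_
      rw [Nat.succPNat_coe, Nat.succ_eq_add_one, veryWellPoisedTerm_inv hρ z₂, d₂, c₂]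
    · refine v₁.pnat fun n => ?_
      rw [Nat.succPNat_coe, Nat.succ_eq_add_one, veryWellPoisedTerm_inv hρ z₁, d₁, f₁, c₁]
    · rw [div_mul_eq_mul_div, eq_div_iff hIq]
      linear_combination -hL
  · obtain ⟨τ₁, v₁, w₁⟩ := hasSum_transformation_of_eq_neg_one (x := 0) hp0 hp z₁ (by simp)
    obtain ⟨τ₂, v₂, w₂⟩ := hasSum_transformation_of_eq_neg_one (x := 0) hp0 hp z₂ (by simp)
    refine ⟨_, τ₂, τ₁, hasSum_odd_part hq w₁ w₂, ?_, ?_, ?_⟩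
    · refine v₂.pnat fun n => ?_
      rw [Nat.succPNat_coe, Nat.succ_eq_add_one, veryWellPoisedTerm_zero z₂, d₂]
    · refine v₁.pnat fun n => ?_
      rw [Nat.succPNat_coe, Nat.succ_eq_add_one, veryWellPoisedTerm_zero z₁, d₁, f₁]
    · rw [one_div, ← mul_add, inv_mul_eq_div, eq_div_iff hIq]
      linear_combination -hL
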